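/- Let $d\ge 3$ and $k\ge 0$ be integers, and let $T\subset\mathbb R^d$ be a clean $k$-point lattice $d$-simplex, i.e. a nondegenerate $d$-simplex with vertex set $V(T)\subset\mathbb Z^d$ such that $\partial T\cap\mathbb Z^d=V(T)$ and exactly $k$ points of $\mathbb Z^d$ lie in $\operatorname{int}(T)$. Suppose $\operatorname{Vol}(T)=\frac{dk+1}{d!}$. A triangulation of a finite set $A\subset\mathbb R^d$ not contained in a hyperplane is a set $\mathcal T$ of nondegenerate $d$-simplices such that: all vertices of each simplex belong to $A$; the interiors of distinct simplices are disjoint; each facet of a simplex either lies in the boundary of $\operatorname{conv}(A)$ or is a common facet of exactly two simplices of $\mathcal T$; no simplex contains a point of $A$ other than its vertices; the union of the vertex sets of the simplices is $A$, and the union of the simplices is $\operatorname{conv}(A)$. Then $T\cap\mathbb Z^d$ has exactly one triangulation. Moreover, there is a vertex $v$ of $T$ that is collinear with $\operatorname{int}(T)\cap\mathbb Z^d$ (all these points lie on one line), and for every such vertex $v$ the following holds. Write $V(T)=\{v_1,\dots,v_{d+1}\}$ with $v_{d+1}=v$; if $k\ge1$, let $w_1$ be a point of $\operatorname{int}(T)\cap\mathbb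 Z^d$ closest to $v$, and put $w_i=v+i(w_1-v)$ for $0\le i\le k$ (if $k=0$, only $w_0=v$ occurs). Then $\operatorname{int}(T)\cap\mathbb Z^d=\{w_1,\dots,w_k\}$, and the unique triangulation of $T\cap\mathbb Z^d$ consists of the simplices $$S_{i,j}=\operatorname{conv}\bigl((V(T)\setminus\{v_j,v_{d+1}\})\cup\{w_i,w_{i-1}\}\bigr),\qquad 1\le i\le k,\ 1\le j\le d,$$ together with $S_{k+1,d}=\operatorname{conv}(v_1,\dots,v_d,w_k)$. -/

import Mathlib

/-- Euclidean space `ℝ^d`. -/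
abbrev RSpace (d : ℕ) : Type := EuclideanSpace ℝ (Fin d)

/-- The integer lattice `ℤ^d` inside `ℝ^d`. -/
def integerLattice (d : ℕ) : Set (RSpace d) :=
  {x | ∀ i, ∃ n : ℤ, x i = (n : ℝ)}

/-- The vertex set of a convex polytope (its set of extreme points). -/
def polyVertices {d : ℕ} (P : Set (RSpace d)) : Set (RSpace d) :=
  P.extremePoints ℝ

/-- `S ⊆ ℝ^d` is a nondegenerate `d`-simplex: the convex hull of `d + 1` affinely
independent points. -/
def IsFullSimplex {d : ℕ} (S : Set (RSpace d)) : Prop :=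
  ∃ V : Finset (RSpace d), V.card = d + 1 ∧
    AffineIndependent ℝ (fun x : V => (x : RSpace d)) ∧
    S = convexHull ℝ (V : Set (RSpace d))

/-- `F` is a facet of the simplex `S`: the convex hull of all vertices of `S` but one. -/
def IsSimplexFacet {d : ℕ} (F S : Set (RSpace d)) : Prop :=
  ∃ x ∈ polyVertices S, F = convexHull ℝ (polyVertices S \ {x})

/-- The lattice points in the interior of `P`. -/
def interiorLatticePoints {d : ℕ} (P : Set (RSpace d)) : Set (RSpace d) :=
  interior P ∩ integerLattice d

/-- `T` is a clean `k`-point lattice `d`-simplex: a `d`-simplex with vertices in `ℤ^d`, whose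
boundary contains no lattice points other than the vertices, and whose interior contains
exactly `k` lattice points. -/
structure IsCleanLatticeSimplex {d : ℕ} (k : ℕ) (T : Set (RSpace d)) : Prop where
  simplex : IsFullSimplex T
  lattice : polyVertices T ⊆ integerLattice d
  clean : frontier T ∩ integerLattice d = polyVertices T
  points : (interiorLatticePoints T).encard = k

/-- `𝒯` is a triangulation of the point set `A` (a finite subset of `ℝ^d` not contained in a
hyperplane). -/
structure IsTriangulation {d : ℕ} (A : Set (RSpace d)) (𝒯 : Set (Set (RSpace d))) : Prop where
  /-- The members of `𝒯` are nondegenerate `d`-simplices. -/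
  simplex : ∀ S ∈ 𝒯, IsFullSimplex S
  /-- All vertices of each simplex belong to `A`. -/
  vertices_subset : ∀ S ∈ 𝒯, polyVertices S ⊆ A
  /-- The interiors of the simplices are pairwise disjoint. -/
  interiors_disjoint : ∀ S ∈ 𝒯, ∀ S' ∈ 𝒯, S ≠ S' → Disjoint (interior S) (interior S')
  /-- Each facet of a simplex lies in the boundary of `conv A`, or else is a common facet of
  exactly two simplices. -/
  facets : ∀ S ∈ 𝒯, ∀ F, IsSimplexFacet F S →
    F ⊆ frontier (convexHull ℝ A) ∨ {S' | S' ∈ 𝒯 ∧ IsSimplexFacet F S'}.encard = 2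
  /-- Each simplex contains no points of `A` other than its vertices. -/
  only_vertices : ∀ S ∈ 𝒯, S ∩ A ⊆ polyVertices S
  /-- Every point of `A` is used: the union of the vertex sets is `A`. -/
  union_vertices : (⋃ S ∈ 𝒯, polyVertices S) = A
  /-- The union of the simplices is `conv A`. -/
  union_simplices : (⋃ S ∈ 𝒯, S) = convexHull ℝ A

/-- The evenly spaced points `w_i = v + i (w₁ - v)` on the line through `v` and `w₁`. -/
noncomputable def rayPoint {d : ℕ} (v w₁ : RSpace d) (i : ℕ) : RSpace d :=
  v + (i : ℝ) • (w₁ - v)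

/-- The simplex `S_{i,x} = conv (V(T) \ {x, v} ∪ {w_i, w_{i-1}})`, used for `1 ≤ i` and for a
vertex `x ≠ v` of `T`. -/
noncomputable def sideSimplex {d : ℕ} (T : Set (RSpace d)) (v w₁ : RSpace d) (i : ℕ)
    (x : RSpace d) : Set (RSpace d) :=
  convexHull ℝ ((polyVertices T \ {x, v}) ∪ {rayPoint v w₁ i, rayPoint v w₁ (i - 1)})

/-- The last simplex `conv (V(T) \ {v} ∪ {w_k})`. -/
noncomputable def lastSimplex {d : ℕ} (T : Set (RSpace d)) (v w₁ : RSpace d) (k : ℕ) :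
    Set (RSpace d) :=
  convexHull ℝ ((polyVertices T \ {v}) ∪ {rayPoint v w₁ k})

/-- The explicit family of all `S_{i,x}` with `1 ≤ i ≤ k` and `x` a vertex of `T` other than `v`,
together with the last simplex. -/
noncomputable def explicitFamily {d : ℕ} (k : ℕ) (T : Set (RSpace d)) (v w₁ : RSpace d) :
    Set (Set (RSpace d)) :=
  {S | ∃ i : ℕ, 1 ≤ i ∧ i ≤ k ∧ ∃ x ∈ polyVertices T \ {v}, S = sideSimplex T v w₁ i x} ∪
    {lastSimplex T v w₁ k}

/-! In homogeneous coordinates `T` is an integer matrix with |det| = d!·Vol(T) = N = dk+1, and by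
Cramer's rule N times a barycentric coordinate of a lattice point is an integer. A lattice point x
cuts the simplex into pieces, the i-th having x in place of the i-th vertex and normalized volume
N·x_i. Another point y lies in the pieces whose index minimizes y_i/x_i. Induction over these cuts
gives `one_add_sum_carrierDim_le`: N is at least 1 plus the sum, over the given lattice points, of
the dimensions of their smallest faces. For k interior points this reads N ≥ dk+1, so the hypothesis
is the equality case.

Equality must hold at every cut (`piece_tight`). Hence, seen from an interior lattice point x, any
other y is either interior to one piece or lies in all pieces but one, that is, on the segment from
x to a vertex. Also, above each facet some interior lattice point has the least possible height 1/N
(`exists_bary_mul_det_eq_one`), so that its piece over that facet is unimodular.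

The core is `exists_isAxis`: the interior lattice points lie on one median. If some point has height
1/N over two facets, unimodularity puts all points on a median. Otherwise two points x, y of height
1/N over different facets see every other point in the interior of a piece. The volumes of their
pieces are then 1 modulo d, so x + (y-x)/d and y + (x-y)/d are lattice points. By induction the
pieces containing them have axes, through x and through y; this makes y a contracting affine
function of x off one index and x one of y off another. Two coordinates of x then agree, which is
excluded. The argument needs two indices outside any given pair, hence d ≥ 3.

Conversely, once the interior points are collinear with a vertex v, heights 1/N over the facets
through v force w_i to have all coordinates other than that of v equal to i/N
(`isMedianChain_rayPoint`). Explicit coordinates of the S_{i,j} turn the triangulation axioms into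
linear inequalities (`IsMedianChain.isTriangulation`). Any simplex admissible in a triangulation
belongs to the family (`IsMedianChain.mem_chainFamily`): it has two consecutive w's as vertices, or
only w_k. A subfamily that still covers `T` is the whole family (`IsTriangulation.eq_of_subset`). -/

set_option linter.unusedSectionVars false

/-! ### Barycentric coordinates, exchange of a vertex, and face dimensions -/

section Barycentric

variable {ι : Type*} [Fintype ι] [DecidableEq ι]

/-- The coordinates of `p` with respect to the rows of `M`, by Cramer's rule. -/
noncomputable def bary (M : Matrix ι ι ℝ) (p : ι → ℝ) (i : ι) : ℝ :=
  (M.updateRow i p).det / M.det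

theorem sum_bary_smul {M : Matrix ι ι ℝ} (hM : M.det ≠ 0) (p : ι → ℝ) :
    ∑ i, bary M p i • M i = p := by
  have h := Matrix.mulVec_cramer M.transpose p
  rw [Matrix.det_transpose] at h
  ext j
  have hj := congrFun h j
  simp only [Matrix.mulVec, dotProduct, Matrix.transpose_apply, Matrix.cramer_transpose_apply,
    Pi.smul_apply, smul_eq_mul] at hj
  simp only [Finset.sum_apply, Pi.smul_apply, smul_eq_mul, bary]
  have : ∑ i, (M.updateRow i p).det / M.det * M i j
      = (∑ i, M i j * (M.updateRow i p).det) / M.det := by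
    rw [Finset.sum_div]
    exact Finset.sum_congr rfl fun i _ => by ring
  rw [this, hj, mul_div_cancel_left₀ _ hM]

theorem bary_sum_smul {M : Matrix ι ι ℝ} (hM : M.det ≠ 0) (c : ι → ℝ) :
    bary M (∑ i, c i • M i) = c := by
  ext i
  rw [bary, Matrix.det_updateRow_sum, smul_eq_mul, mul_div_cancel_right₀ _ hM]

theorem bary_eq_of_sum {M : Matrix ι ι ℝ} (hM : M.det ≠ 0) {c p : ι → ℝ}
    (h : ∑ i, c i • M i = p) : bary M p = c := by
  rw [← h, bary_sum_smul hM]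

theorem bary_injective {M : Matrix ι ι ℝ} (hM : M.det ≠ 0) : Function.Injective (bary M) := by
  intro p q h
  rw [← sum_bary_smul hM p, ← sum_bary_smul hM q, h]

theorem bary_mul_det {M : Matrix ι ι ℝ} (hM : M.det ≠ 0) (p : ι → ℝ) (i : ι) :
    bary M p i * M.det = (M.updateRow i p).det := by
  rw [bary, div_mul_cancel₀ _ hM]

theorem sum_bary {M : Matrix ι ι ℝ} (hM : M.det ≠ 0) {φ : (ι → ℝ) →ₗ[ℝ] ℝ}
    (hφ : ∀ i, φ (M i) = 1) (p : ι → ℝ) : ∑ i, bary M p i = φ p := by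
  conv_rhs => rw [← sum_bary_smul hM p]
  simp [map_sum, hφ]

/-- The coordinates of a point after the `i`-th member of a frame is replaced: `e` and `a` are the
old coordinates of the new member and of the point. -/
noncomputable def replaceCoord (e a : ι → ℝ) (i : ι) : ι → ℝ :=
  Function.update (fun l => a l - a i / e i * e l) i (a i / e i)

theorem replaceCoord_same (e a : ι → ℝ) (i : ι) : replaceCoord e a i i = a i / e i := by
  simp [replaceCoord]

theorem replaceCoord_ne (e a : ι → ℝ) {i l : ι} (h : l ≠ i) :
    replaceCoord e a i l = a l - a i / e i * e l := by
  simp [replaceCoord, h]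

/-- The pivot step of linear algebra: solve the expansion of x for `M i` and substitute it into that
of p. -/
theorem bary_updateRow {M : Matrix ι ι ℝ} (hM : M.det ≠ 0) {x : ι → ℝ} {i : ι}
    (hx : bary M x i ≠ 0) (p : ι → ℝ) :
    bary (M.updateRow i x) p = replaceCoord (bary M x) (bary M p) i := by
  have hdet : (M.updateRow i x).det ≠ 0 := by
    rw [← bary_mul_det hM]; exact mul_ne_zero hx hM
  apply bary_eq_of_sum hdet
  have h1 : ∀ l ∈ Finset.univ.erase i,
      replaceCoord (bary M x) (bary M p) i l • (M.updateRow i x) l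
        = bary M p l • M l - (bary M p i / bary M x i) • (bary M x l • M l) := by
    intro l hl
    have hl := Finset.ne_of_mem_erase hl
    rw [replaceCoord_ne _ _ hl, Matrix.updateRow_ne hl, sub_smul, smul_smul]
  rw [← Finset.add_sum_erase _ _ (Finset.mem_univ i), Finset.sum_congr rfl h1,
    Finset.sum_sub_distrib, ← Finset.smul_sum, replaceCoord_same, Matrix.updateRow_self]
  have hp := sum_bary_smul hM p
  have hx' := sum_bary_smul hM x
  rw [← Finset.add_sum_erase _ _ (Finset.mem_univ i)] at hp hx'
  rw [eq_sub_of_add_eq' hp, eq_sub_of_add_eq' hx', smul_sub, smul_smul, div_mul_cancel₀ _ hx]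
  abel

/-- A point is in the i-th piece exactly when a/e is least at i. The cross-multiplied form also
covers indices with e l = 0. -/
theorem replaceCoord_nonneg_iff {e a : ι → ℝ} {i : ι} (he : 0 < e i) (ha : 0 ≤ a i) :
    (∀ l, 0 ≤ replaceCoord e a i l) ↔ ∀ l, a i * e l ≤ a l * e i := by
  have key : ∀ l, 0 ≤ a l - a i / e i * e l ↔ a i * e l ≤ a l * e i := by
    intro l
    rw [sub_nonneg, div_mul_eq_mul_div, div_le_iff₀ he]
  constructor
  · intro h l
    by_cases hl : l = i
    · rw [hl]
    · rw [← key]; simpa [replaceCoord_ne _ _ hl] using h l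
  · intro h l
    by_cases hl : l = i
    · rw [hl, replaceCoord_same]; positivity
    · rw [replaceCoord_ne _ _ hl, key]; exact h l

/-- The dimension of the smallest face of a simplex containing the point with coordinates `c`. -/
noncomputable def carrierDim (c : ι → ℝ) : ℝ := ((Finset.univ.filter (c · ≠ 0)).card : ℝ) - 1

/-- The indices at which the ratio `a / e` is minimal. -/
noncomputable def ratioMin (e a : ι → ℝ) : Finset ι :=
  Finset.univ.filter fun i => 0 < e i ∧ ∀ l, a i * e l ≤ a l * e i

theorem mem_ratioMin {e a : ι → ℝ} {i : ι} :
    i ∈ ratioMin e a ↔ 0 < e i ∧ ∀ l, a i * e l ≤ a l * e i := by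
  simp [ratioMin]

theorem exists_pos_of_sum_one {e : ι → ℝ} (hs : ∑ i, e i = 1) : ∃ i, 0 < e i := by
  by_contra! h
  linarith [Finset.sum_nonpos fun i (_ : i ∈ Finset.univ) => h i]

theorem ratioMin_nonempty {e a : ι → ℝ} (he : ∀ i, 0 ≤ e i) (hs : ∑ i, e i = 1)
    (ha : ∀ i, 0 ≤ a i) : (ratioMin e a).Nonempty := by
  obtain ⟨j, hj⟩ := exists_pos_of_sum_one hs
  obtain ⟨i, hi, hmin⟩ := Finset.exists_min_image (Finset.univ.filter (0 < e ·))
    (fun i => a i / e i) ⟨j, by simpa using hj⟩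
  have hi : 0 < e i := by simpa using hi
  refine ⟨i, mem_ratioMin.2 ⟨hi, fun l => ?_⟩⟩
  rcases (he l).lt_or_eq with hl | hl
  · have := hmin l (by simpa using hl)
    rwa [div_le_div_iff₀ hi hl] at this
  · rw [← hl, mul_zero]; exact mul_nonneg (ha l) hi.le

theorem ratioMin_ratio_eq {e a : ι → ℝ} {i j : ι} (hi : i ∈ ratioMin e a)
    (hj : j ∈ ratioMin e a) : a i * e j = a j * e i :=
  le_antisymm ((mem_ratioMin.1 hi).2 j) ((mem_ratioMin.1 hj).2 i)

theorem mem_ratioMin_of_ratio_eq {e a : ι → ℝ} {i j : ι} (hi : i ∈ ratioMin e a)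
    (hj : 0 < e j) (h : a i * e j = a j * e i) : j ∈ ratioMin e a := by
  obtain ⟨hi0, hi⟩ := mem_ratioMin.1 hi
  refine mem_ratioMin.2 ⟨hj, fun l => ?_⟩
  have := hi l
  have h2 : e i * (a j * e l) ≤ e i * (a l * e j) := by
    calc e i * (a j * e l) = (a j * e i) * e l := by ring
      _ = (a i * e l) * e j := by rw [← h]; ring
      _ ≤ (a l * e i) * e j := by gcongr
      _ = _ := by ring
  exact le_of_mul_le_mul_left h2 hi0

/-- The exchange kills exactly the coordinates at the minimizing indices other than i. No coordinate
is revived: the minimal ratio is positive, so a l = 0 forces e l = 0. -/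
theorem carrierDim_replaceCoord {e a : ι → ℝ} (he : ∀ i, 0 ≤ e i) {i : ι}
    (hi : i ∈ ratioMin e a) (hai : 0 < a i) :
    carrierDim (replaceCoord e a i)
      = (Finset.univ.filter (a · ≠ 0)).card - (ratioMin e a).card := by
  have hi0 := (mem_ratioMin.1 hi).1
  have hsub : ratioMin e a ⊆ Finset.univ.filter (a · ≠ 0) := by
    intro j hj
    have h := ratioMin_ratio_eq hi hj
    have hj0 := (mem_ratioMin.1 hj).1
    have : 0 < a j * e i := h ▸ mul_pos hai hj0
    simp only [Finset.mem_filter, Finset.mem_univ, true_and]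
    exact fun h0 => by simp [h0] at this
  have hset : Finset.univ.filter (replaceCoord e a i · ≠ 0)
      = insert i (Finset.univ.filter (a · ≠ 0) \ ratioMin e a) := by
    ext l
    simp only [Finset.mem_filter, Finset.mem_univ, true_and, Finset.mem_insert, Finset.mem_sdiff]
    by_cases hl : l = i
    · subst hl
      simp [replaceCoord_same, hai.ne', hi0.ne']
    · rw [replaceCoord_ne _ _ hl]
      have h3 : a l - a i / e i * e l = 0 ↔ a i * e l = a l * e i := by
        rw [sub_eq_zero, div_mul_eq_mul_div, eq_div_iff hi0.ne', eq_comm]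
      simp only [hl, false_or, ne_eq, h3]
      rcases (he l).lt_or_eq with h | h
      · constructor
        · intro h4
          refine ⟨fun h5 => ?_, fun h5 => h4 (ratioMin_ratio_eq hi h5)⟩
          have := (mem_ratioMin.1 hi).2 l
          rw [h5, zero_mul] at this
          linarith [mul_pos hai h]
        · exact fun h4 h5 => h4.2 (mem_ratioMin_of_ratio_eq hi h h5)
      · have : l ∉ ratioMin e a := fun h5 => by
          have := (mem_ratioMin.1 h5).1; linarith
        simp [← h, this, hi0.ne', eq_comm]
  rw [carrierDim, hset, Finset.card_insert_of_notMem (by simp [hi]), Finset.card_sdiff_of_subset hsub]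
  push_cast [Finset.card_le_card hsub]
  ring

theorem carrierDim_nonneg {a : ι → ℝ} (hs : ∑ i, a i = 1) : 0 ≤ carrierDim a := by
  obtain ⟨i, hi⟩ := exists_pos_of_sum_one hs
  have : 1 ≤ (Finset.univ.filter (a · ≠ 0)).card :=
    Finset.card_pos.2 ⟨i, by simp [hi.ne']⟩
  rw [carrierDim, sub_nonneg]
  exact_mod_cast this

/-- If the ratio were minimal on the whole support of a, then a would be proportional to e, and
equal to it since both sum to 1. -/
theorem ratioMin_card_lt {e a : ι → ℝ} (he : ∀ i, 0 ≤ e i) (hse : ∑ i, e i = 1)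
    (hsa : ∑ i, a i = 1) (hea : e ≠ a) {i : ι} (hi : i ∈ ratioMin e a)
    (hai : 0 < a i) :
    (ratioMin e a).card < (Finset.univ.filter (a · ≠ 0)).card := by
  have hi0 := (mem_ratioMin.1 hi).1
  apply Finset.card_lt_card
  refine (Finset.ssubset_iff_of_subset fun j hj => ?_).2 ?_
  · have h := ratioMin_ratio_eq hi hj
    have : 0 < a j * e i := h ▸ mul_pos hai (mem_ratioMin.1 hj).1
    simp only [Finset.mem_filter, Finset.mem_univ, true_and]
    exact fun h0 => by simp [h0] at this
  · by_contra! h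
    apply hea
    have h1 : ∀ l, a i * e l = a l * e i := by
      intro l
      by_cases hl : a l = 0
      · have := (mem_ratioMin.1 hi).2 l
        rw [hl, zero_mul] at this ⊢
        exact le_antisymm this (mul_nonneg hai.le (he l))
      · exact ratioMin_ratio_eq hi (h l (by simp [hl]))
    have h2 : a i = e i := by
      have := Finset.sum_congr rfl fun l (_ : l ∈ Finset.univ) => h1 l
      rwa [← Finset.mul_sum, ← Finset.sum_mul, hse, hsa, mul_one, one_mul] at this
    ext l
    have := h1 l
    rw [h2, mul_comm] at this
    exact mul_right_cancel₀ hi0.ne' this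

/-- With m the size of the support of a and c the number of minimizing indices, a positive minimal
ratio gives the bound c(m-c) ≥ m-1, that is (c-1)(m-c-1) ≥ 0. If the minimal ratio is 0, the
exchange leaves a unchanged. -/
theorem carrierDim_le_sum_replaceCoord {e a : ι → ℝ} (he : ∀ i, 0 ≤ e i) (hse : ∑ i, e i = 1)
    (ha : ∀ i, 0 ≤ a i) (hsa : ∑ i, a i = 1) (hea : e ≠ a) :
    carrierDim a ≤ ∑ i ∈ ratioMin e a, carrierDim (replaceCoord e a i) := by
  obtain ⟨i, hi⟩ := ratioMin_nonempty he hse ha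
  have hi0 := (mem_ratioMin.1 hi).1
  rcases (ha i).lt_or_eq with hai | hai
  · have hlt := ratioMin_card_lt he hse hsa hea hi hai
    have hpos : ∀ j ∈ ratioMin e a, 0 < a j := fun j hj => by
      have h := ratioMin_ratio_eq hi hj
      have : 0 < a j * e i := h ▸ mul_pos hai (mem_ratioMin.1 hj).1
      exact pos_of_mul_pos_left this hi0.le
    rw [Finset.sum_congr rfl fun j hj => carrierDim_replaceCoord he hj (hpos j hj),
      Finset.sum_const, nsmul_eq_mul, carrierDim]
    have h1 : 1 ≤ (ratioMin e a).card := Finset.card_pos.2 ⟨i, hi⟩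
    have h1' : (1 : ℝ) ≤ (ratioMin e a).card := by exact_mod_cast h1
    have h2' : ((ratioMin e a).card : ℝ) + 1 ≤ (Finset.univ.filter (a · ≠ 0)).card := by
      exact_mod_cast hlt
    nlinarith [mul_nonneg (sub_nonneg.2 h1') (sub_nonneg.2 h2')]
  · have hzero : ∀ j ∈ ratioMin e a, replaceCoord e a j = a := fun j hj => by
      have h := ratioMin_ratio_eq hi hj
      rw [← hai, zero_mul] at h
      have : a j = 0 := by simpa [hi0.ne'] using h.symm
      ext l
      by_cases hl : l = j
      · rw [hl, replaceCoord_same, this, zero_div]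
      · rw [replaceCoord_ne _ _ hl, this]; ring
    rw [Finset.sum_congr rfl fun j hj => by rw [hzero j hj], Finset.sum_const, nsmul_eq_mul]
    have h1 : (1 : ℝ) ≤ (ratioMin e a).card := by
      exact_mod_cast (Finset.card_pos.2 ⟨i, hi⟩ : 0 < _)
    nlinarith [carrierDim_nonneg hsa]

end Barycentric

/-! ### Lattice simplices: the volume bound and its equality case -/

section LatticeFrames

variable {ι : Type*} [Fintype ι] [DecidableEq ι]

/-- An integer vector on the affine hyperplane `φ = 1`. -/
def IsLatticePoint (φ : (ι → ℝ) →ₗ[ℝ] ℝ) (p : ι → ℝ) : Prop :=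
  (∀ i, ∃ n : ℤ, p i = n) ∧ φ p = 1

/-- A matrix whose rows are the vertices of a lattice simplex in the hyperplane `φ = 1`. -/
structure IsLatticeFrame (φ : (ι → ℝ) →ₗ[ℝ] ℝ) (M : Matrix ι ι ℝ) : Prop where
  row : ∀ i, IsLatticePoint φ (M i)
  det_ne : M.det ≠ 0

theorem exists_int_det {M : Matrix ι ι ℝ} (h : ∀ i j, ∃ n : ℤ, M i j = n) :
    ∃ n : ℤ, M.det = n := by
  choose m hm using h
  refine ⟨(Matrix.of m).det, ?_⟩
  have h1 : M = (Matrix.of m).map (Int.castRingHom ℝ) := by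
    ext i j; simp [hm]
  rw [h1, ← RingHom.mapMatrix_apply, ← RingHom.map_det]
  rfl

namespace IsLatticeFrame

variable {φ : (ι → ℝ) →ₗ[ℝ] ℝ} {M : Matrix ι ι ℝ}

theorem sum_bary (hM : IsLatticeFrame φ M) {p : ι → ℝ} (hp : IsLatticePoint φ p) :
    ∑ i, bary M p i = 1 := by
  rw [_root_.sum_bary hM.det_ne (fun i => (hM.row i).2), hp.2]

theorem one_le_abs_det (hM : IsLatticeFrame φ M) : 1 ≤ |M.det| := by
  obtain ⟨n, hn⟩ := exists_int_det fun i j => (hM.row i).1 j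
  have h := hM.det_ne
  rw [hn] at h ⊢
  exact_mod_cast Int.one_le_abs (by exact_mod_cast h)

theorem updateRow (hM : IsLatticeFrame φ M) {x : ι → ℝ} (hx : IsLatticePoint φ x) {i : ι}
    (hi : bary M x i ≠ 0) : IsLatticeFrame φ (M.updateRow i x) where
  row j := by
    by_cases h : j = i
    · subst h; rwa [Matrix.updateRow_self]
    · rw [Matrix.updateRow_ne h]; exact hM.row j
  det_ne := by
    rw [← bary_mul_det hM.det_ne]; exact mul_ne_zero hi hM.det_ne

theorem exists_int_bary_mul_det (hM : IsLatticeFrame φ M) {p : ι → ℝ} (hp : IsLatticePoint φ p)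
    (i : ι) : ∃ n : ℤ, bary M p i * |M.det| = n := by
  have h : ∃ n : ℤ, bary M p i * M.det = n := by
    rw [bary_mul_det hM.det_ne]
    apply exists_int_det
    intro j l
    by_cases h : j = i
    · subst h; rw [Matrix.updateRow_self]; exact hp.1 l
    · rw [Matrix.updateRow_ne h]; exact (hM.row j).1 l
  obtain ⟨n, hn⟩ := h
  rcases abs_choice M.det with h | h
  · exact ⟨n, by rw [h, hn]⟩
  · exact ⟨-n, by rw [h, mul_neg, hn]; push_cast; ring⟩

theorem sum_abs_det (hM : IsLatticeFrame φ M) {x : ι → ℝ} (hx : IsLatticePoint φ x) :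
    ∑ i, bary M x i * |M.det| = |M.det| := by
  rw [← Finset.sum_mul, hM.sum_bary hx, one_mul]

end IsLatticeFrame

theorem abs_det_updateRow {M : Matrix ι ι ℝ} (hM : M.det ≠ 0) {x : ι → ℝ} {i : ι}
    (hx : 0 ≤ bary M x i) : |(M.updateRow i x).det| = bary M x i * |M.det| := by
  rw [← bary_mul_det hM, abs_mul, abs_of_nonneg hx]

open Classical in
/-- The points of `P` other than `x` that lie in the simplex obtained from the frame `M` by
replacing the `i`-th vertex by `x`. -/
noncomputable def piece (M : Matrix ι ι ℝ) (P : Finset (ι → ℝ)) (x : ι → ℝ) (i : ι) :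
    Finset (ι → ℝ) :=
  (P.erase x).filter fun y => i ∈ ratioMin (bary M x) (bary M y)

theorem mem_piece {M : Matrix ι ι ℝ} {P : Finset (ι → ℝ)} {x y : ι → ℝ} {i : ι} :
    y ∈ piece M P x i ↔ (y ≠ x ∧ y ∈ P) ∧ i ∈ ratioMin (bary M x) (bary M y) := by
  simp [piece]

open Classical in
theorem sum_piece {M : Matrix ι ι ℝ} {P : Finset (ι → ℝ)} {x : ι → ℝ}
    (f : ι → (ι → ℝ) → ℝ) :
    ∑ i ∈ Finset.univ.filter (0 < bary M x ·), ∑ y ∈ piece M P x i, f i y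
      = ∑ y ∈ P.erase x, ∑ i ∈ ratioMin (bary M x) (bary M y), f i y := by
  apply Finset.sum_comm'
  intro i y
  simp only [Finset.mem_filter, Finset.mem_univ, true_and, mem_piece, Finset.mem_erase]
  constructor
  · rintro ⟨-, h, h'⟩; exact ⟨h', h⟩
  · rintro ⟨h', h⟩; exact ⟨(mem_ratioMin.1 h').1, h, h'⟩

/-- Cut at a point x of P and apply induction to each nondegenerate piece. The volumes add up to
|det|, and no point loses total face dimension by being distributed over the pieces containing it.
-/
theorem one_add_sum_carrierDim_le {φ : (ι → ℝ) →ₗ[ℝ] ℝ} {M : Matrix ι ι ℝ}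
    (hM : IsLatticeFrame φ M) (P : Finset (ι → ℝ))
    (hP : ∀ p ∈ P, IsLatticePoint φ p ∧ ∀ i, 0 ≤ bary M p i) :
    1 + ∑ p ∈ P, carrierDim (bary M p) ≤ |M.det| := by
  classical
  induction hn : P.card using Nat.strong_induction_on generalizing M P with
  | _ n ih =>
  subst hn
  rcases P.eq_empty_or_nonempty with rfl | ⟨x, hxP⟩
  · simpa using hM.one_le_abs_det
  obtain ⟨hx, hx0⟩ := hP x hxP
  have hpiece : ∀ i ∈ Finset.univ.filter (0 < bary M x ·),
      1 + ∑ y ∈ piece M P x i, carrierDim (replaceCoord (bary M x) (bary M y) i)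
        ≤ bary M x i * |M.det| := by
    intro i hi
    have hi : 0 < bary M x i := by simpa using hi
    rw [← abs_det_updateRow hM.det_ne hi.le]
    have hsub : piece M P x i ⊆ P.erase x := Finset.filter_subset _ _
    have := ih (piece M P x i).card
      ((Finset.card_le_card hsub).trans_lt (Finset.card_erase_lt_of_mem hxP))
      (hM.updateRow hx hi.ne') (piece M P x i) (fun y hy => ?_) rfl
    · simpa only [bary_updateRow hM.det_ne hi.ne'] using this
    · rw [mem_piece] at hy
      obtain ⟨hy1, hy2⟩ := hP y hy.1.2
      refine ⟨hy1, ?_⟩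
      rw [bary_updateRow hM.det_ne hi.ne', replaceCoord_nonneg_iff hi (hy2 i)]
      exact (mem_ratioMin.1 hy.2).2
  have hsum := Finset.sum_le_sum hpiece
  rw [Finset.sum_add_distrib, sum_piece, Finset.sum_const, nsmul_eq_mul, mul_one] at hsum
  have htot : ∑ i ∈ Finset.univ.filter (0 < bary M x ·), bary M x i * |M.det| = |M.det| := by
    conv_rhs => rw [← hM.sum_abs_det hx]
    apply Finset.sum_subset (Finset.subset_univ _)
    intro i _ hi
    have : bary M x i = 0 := le_antisymm (by simpa using hi) (hx0 i)
    rw [this, zero_mul]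
  have hle : ∑ y ∈ P.erase x, carrierDim (bary M y) ≤ ∑ y ∈ P.erase x,
      ∑ i ∈ ratioMin (bary M x) (bary M y),
        carrierDim (replaceCoord (bary M x) (bary M y) i) := by
    apply Finset.sum_le_sum
    intro y hy
    obtain ⟨hy1, hy2⟩ := hP y (Finset.mem_of_mem_erase hy)
    refine carrierDim_le_sum_replaceCoord hx0 (hM.sum_bary hx) hy2 (hM.sum_bary hy1) ?_
    exact fun h => Finset.ne_of_mem_erase hy (bary_injective hM.det_ne h).symm
  -- The summand 1 occurs once per nondegenerate piece. These number one more than the dimension of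
  -- the face of x, so they pay for the 1 on the left and for x itself.
  have hcx : carrierDim (bary M x)
      = ((Finset.univ.filter (0 < bary M x ·)).card : ℝ) - 1 := by
    rw [carrierDim]
    congr 3
    ext i
    simp [(hx0 i).lt_iff_ne, eq_comm]
  rw [← Finset.add_sum_erase _ _ hxP]
  linarith

/-- A lattice simplex whose volume is the least possible for its number of interior lattice
points; `A` is the set of these points. -/
structure IsTightFrame (φ : (ι → ℝ) →ₗ[ℝ] ℝ) (M : Matrix ι ι ℝ) (A : Finset (ι → ℝ)) : Prop
    extends IsLatticeFrame φ M where
  mem_iff : ∀ p, p ∈ A ↔ IsLatticePoint φ p ∧ ∀ i, 0 < bary M p i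
  det_eq : |M.det| = 1 + ((Fintype.card ι : ℝ) - 1) * A.card

theorem carrierDim_of_pos {a : ι → ℝ} (ha : ∀ i, 0 < a i) :
    carrierDim a = (Fintype.card ι : ℝ) - 1 := by
  rw [carrierDim, Finset.filter_true_of_mem fun i _ => (ha i).ne', Finset.card_univ]

theorem sum_carrierDim_replaceCoord_of_pos {e a : ι → ℝ} (he : ∀ i, 0 < e i)
    (ha : ∀ i, 0 < a i) : ∑ i ∈ ratioMin e a, carrierDim (replaceCoord e a i)
      = (ratioMin e a).card * ((Fintype.card ι : ℝ) - (ratioMin e a).card) := by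
  rw [Finset.sum_congr rfl fun i hi =>
      carrierDim_replaceCoord (fun i => (he i).le) hi (ha i),
    Finset.sum_const, nsmul_eq_mul, Finset.filter_true_of_mem fun i _ => (ha i).ne',
    Finset.card_univ]

namespace IsTightFrame

variable {φ : (ι → ℝ) →ₗ[ℝ] ℝ} {M : Matrix ι ι ℝ} {A : Finset (ι → ℝ)}

theorem latticePoint (hM : IsTightFrame φ M A) {p : ι → ℝ} (hp : p ∈ A) : IsLatticePoint φ p :=
  ((hM.mem_iff p).1 hp).1

theorem pos (hM : IsTightFrame φ M A) {p : ι → ℝ} (hp : p ∈ A) (i : ι) : 0 < bary M p i :=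
  ((hM.mem_iff p).1 hp).2 i

/-- Both estimates in the proof of the volume bound are sums of termwise inequalities, so equality
of the totals forces equality of all terms. For n = `Fintype.card ι` and c minimizing indices, the
second equality c(n-c) = n-1 factors as (c-1)(c+1-n) = 0. -/
theorem piece_tight (hM : IsTightFrame φ M A) {x : ι → ℝ} (hx : x ∈ A) :
    (∀ i, 1 + ∑ y ∈ piece M A x i, carrierDim (replaceCoord (bary M x) (bary M y) i)
      = bary M x i * |M.det|) ∧
    ∀ y ∈ A, y ≠ x → (ratioMin (bary M x) (bary M y)).card = 1 ∨
      (ratioMin (bary M x) (bary M y)).card + 1 = Fintype.card ι := by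
  classical
  have hx0 := hM.pos hx
  have hxl := hM.latticePoint hx
  have hM' := hM.toIsLatticeFrame
  have hpiece : ∀ i ∈ Finset.univ.filter (0 < bary M x ·),
      1 + ∑ y ∈ piece M A x i, carrierDim (replaceCoord (bary M x) (bary M y) i)
        ≤ bary M x i * |M.det| := by
    intro i _
    have hi := hx0 i
    rw [← abs_det_updateRow hM.det_ne hi.le]
    have := one_add_sum_carrierDim_le (hM'.updateRow hxl hi.ne') (piece M A x i) fun y hy => ?_
    · simpa only [bary_updateRow hM.det_ne hi.ne'] using this
    · rw [mem_piece] at hy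
      refine ⟨hM.latticePoint hy.1.2, ?_⟩
      rw [bary_updateRow hM.det_ne hi.ne', replaceCoord_nonneg_iff hi (hM.pos hy.1.2 i).le]
      exact (mem_ratioMin.1 hy.2).2
  have hle : ∀ y ∈ A.erase x, carrierDim (bary M y) ≤
      ∑ i ∈ ratioMin (bary M x) (bary M y),
        carrierDim (replaceCoord (bary M x) (bary M y) i) := by
    intro y hy
    have hyA := Finset.mem_of_mem_erase hy
    refine carrierDim_le_sum_replaceCoord (fun i => (hx0 i).le) (hM'.sum_bary hxl)
      (fun i => (hM.pos hyA i).le) (hM'.sum_bary (hM.latticePoint hyA)) ?_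
    exact fun h => Finset.ne_of_mem_erase hy (bary_injective hM.det_ne h).symm
  have hfilter : Finset.univ.filter (0 < bary M x ·) = Finset.univ :=
    Finset.filter_true_of_mem fun i _ => hx0 i
  have h1 := Finset.sum_le_sum hpiece
  have h2 := Finset.sum_le_sum hle
  have h3 := hM.det_eq
  have h4 : ∑ y ∈ A.erase x, carrierDim (bary M y)
      = ((Fintype.card ι : ℝ) - 1) * A.card - ((Fintype.card ι : ℝ) - 1) := by
    rw [Finset.sum_congr rfl fun y hy =>
      carrierDim_of_pos (hM.pos (Finset.mem_of_mem_erase hy)), Finset.sum_const, nsmul_eq_mul,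
      Finset.card_erase_of_mem hx, Nat.cast_sub (Finset.card_pos.2 ⟨x, hx⟩)]
    push_cast; ring
  have h5 := h1
  rw [Finset.sum_add_distrib, sum_piece, Finset.sum_const, nsmul_eq_mul, mul_one, hfilter,
    hM'.sum_abs_det hxl, Finset.card_univ] at h5
  constructor
  · have h6 := (Finset.sum_eq_sum_iff_of_le hpiece).1 (le_antisymm h1 (by
      rw [Finset.sum_add_distrib, sum_piece, Finset.sum_const, nsmul_eq_mul, mul_one, hfilter,
        hM'.sum_abs_det hxl, Finset.card_univ]
      linarith))
    exact fun i => h6 i (by simp [hfilter])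
  · intro y hy hyx
    have h6 := (Finset.sum_eq_sum_iff_of_le hle).1 (le_antisymm h2 (by linarith)) y
      (by simp [hy, hyx])
    rw [carrierDim_of_pos (hM.pos hy), sum_carrierDim_replaceCoord_of_pos hx0 (hM.pos hy)] at h6
    have h7 : (((ratioMin (bary M x) (bary M y)).card : ℝ) - 1)
        * ((ratioMin (bary M x) (bary M y)).card + 1 - Fintype.card ι) = 0 := by linarith
    rcases mul_eq_zero.1 h7 with h | h
    · left; exact_mod_cast sub_eq_zero.1 h
    · right; exact_mod_cast sub_eq_zero.1 h

theorem mem_piece_iff (hM : IsTightFrame φ M A) {x y : ι → ℝ} (hx : x ∈ A) {i : ι} :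
    y ∈ piece M A x i ↔ (y ≠ x ∧ y ∈ A) ∧ ∀ l, 0 ≤ bary (M.updateRow i x) y l := by
  rw [mem_piece]
  refine and_congr_right fun h => ?_
  rw [bary_updateRow hM.det_ne (hM.pos hx i).ne',
    replaceCoord_nonneg_iff (hM.pos hx i) (hM.pos h.2 i).le, mem_ratioMin,
    and_iff_right (hM.pos hx i)]

theorem replaceCoord_pos_of_card (hM : IsTightFrame φ M A) {x y : ι → ℝ} (hx : x ∈ A)
    (hy : y ∈ A) {i : ι}
    (hi : i ∈ ratioMin (bary M x) (bary M y)) (hc : (ratioMin (bary M x) (bary M y)).card = 1)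
    (l : ι) : 0 < replaceCoord (bary M x) (bary M y) i l := by
  obtain ⟨j, hj⟩ := Finset.card_eq_one.1 hc
  have hij : i = j := by simpa [hj] using hi
  subst hij
  by_cases hl : l = i
  · rw [hl, replaceCoord_same]; exact div_pos (hM.pos hy i) (hM.pos hx i)
  · have h0 := (replaceCoord_nonneg_iff (hM.pos hx i) (hM.pos hy i).le).2 (mem_ratioMin.1 hi).2 l
    refine h0.lt_of_ne fun h => hl ?_
    rw [replaceCoord_ne _ _ hl, eq_comm, sub_eq_zero, div_mul_eq_mul_div,
      eq_div_iff (hM.pos hx i).ne'] at h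
    have := mem_ratioMin_of_ratio_eq hi (hM.pos hx l) h.symm
    simpa [hj] using this

/-- A piece of a tight simplex is tight if it contains no points on its boundary. -/
theorem updateRow (hM : IsTightFrame φ M A) (hι : 2 ≤ Fintype.card ι) {x : ι → ℝ} (hx : x ∈ A)
    {i : ι} (h : ∀ y ∈ piece M A x i, (ratioMin (bary M x) (bary M y)).card = 1) :
    IsTightFrame φ (M.updateRow i x) (piece M A x i) := by
  have hi := hM.pos hx i
  have hpos : ∀ y ∈ piece M A x i, ∀ l, 0 < replaceCoord (bary M x) (bary M y) i l :=
    fun y hy => by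
      obtain ⟨⟨-, hy1⟩, hy2⟩ := mem_piece.1 hy
      exact hM.replaceCoord_pos_of_card hx hy1 hy2 (h y hy)
  refine ⟨hM.toIsLatticeFrame.updateRow (hM.latticePoint hx) hi.ne', fun p => ⟨?_, ?_⟩, ?_⟩
  · intro hp
    refine ⟨hM.latticePoint (mem_piece.1 hp).1.2, ?_⟩
    rw [bary_updateRow hM.det_ne hi.ne']
    exact hpos p hp
  · rintro ⟨hp, hp0⟩
    have hp0' := hp0
    rw [bary_updateRow hM.det_ne hi.ne'] at hp0
    have hpi : 0 < bary M p i := by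
      have := hp0 i
      rw [replaceCoord_same] at this
      exact (div_pos_iff_of_pos_right hi).1 this
    -- The interior of a piece lies in the interior of the whole simplex.
    have hpA : p ∈ A := by
      refine (hM.mem_iff p).2 ⟨hp, fun l => ?_⟩
      by_cases hl : l = i
      · rwa [hl]
      · have := hp0 l
        rw [replaceCoord_ne _ _ hl] at this
        have h2 : 0 < bary M p i / bary M x i * bary M x l :=
          mul_pos (div_pos hpi hi) (hM.pos hx l)
        linarith
    refine (hM.mem_piece_iff hx).2 ⟨⟨?_, hpA⟩, fun l => (hp0' l).le⟩
    rintro rfl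
    obtain ⟨l, hl⟩ := Fintype.exists_ne_of_one_lt_card hι i
    have := hp0 l
    rw [replaceCoord_ne _ _ hl, div_self hi.ne'] at this
    linarith
  · rw [abs_det_updateRow hM.det_ne hi.le, ← (hM.piece_tight hx).1 i,
      Finset.sum_congr rfl fun y hy => carrierDim_of_pos (hpos y hy), Finset.sum_const,
      nsmul_eq_mul, mul_comm]

theorem card_piece_lt {x : ι → ℝ} (hx : x ∈ A) (i : ι) : (piece M A x i).card < A.card := by
  classical
  exact (Finset.card_le_card (Finset.filter_subset _ _)).trans_lt
    (Finset.card_erase_lt_of_mem hx)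

/-- If the ratio of two points is minimal at all indices but one, then it is constant there. -/
theorem exists_ratio_of_card_ne_one (hM : IsTightFrame φ M A) {x y : ι → ℝ} (hx : x ∈ A)
    (hy : y ∈ A) (hyx : y ≠ x) (h : (ratioMin (bary M x) (bary M y)).card ≠ 1) :
    ∃ j, ∃ r, 0 < r ∧ r < 1 ∧ r * bary M x j < bary M y j ∧
      j ∉ ratioMin (bary M x) (bary M y) ∧
      ∀ l, l ≠ j → bary M y l = r * bary M x l := by
  have hc := ((hM.piece_tight hx).2 y hy hyx).resolve_left h
  -- Geometrically, y lies on the open segment from x to the vertex j of the single index left out;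
  -- r is the weight of x.
  have hcompl : (ratioMin (bary M x) (bary M y))ᶜ.card = 1 := by
    rw [Finset.card_compl, ← hc]; simp
  obtain ⟨j, hj⟩ := Finset.card_eq_one.1 hcompl
  have hmem : ∀ l, l ∈ ratioMin (bary M x) (bary M y) ↔ l ≠ j := by
    intro l
    rw [← not_iff_not, ← Finset.mem_compl, hj]; simp
  obtain ⟨i, hi⟩ := ratioMin_nonempty (fun i => (hM.pos hx i).le)
    (hM.toIsLatticeFrame.sum_bary (hM.latticePoint hx)) (fun i => (hM.pos hy i).le)
  have hxi := hM.pos hx i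
  have heq : ∀ l, l ≠ j → bary M y l = bary M y i / bary M x i * bary M x l := by
    intro l hl
    rw [div_mul_eq_mul_div, eq_div_iff hxi.ne', ratioMin_ratio_eq hi ((hmem l).2 hl)]
  have hj' : bary M y i / bary M x i * bary M x j < bary M y j := by
    refine lt_of_le_of_ne ?_ ?_
    · rw [div_mul_eq_mul_div, div_le_iff₀ hxi]; exact (mem_ratioMin.1 hi).2 j
    · intro h
      rw [div_mul_eq_mul_div, div_eq_iff hxi.ne'] at h
      exact (hmem j).1 (mem_ratioMin_of_ratio_eq hi (hM.pos hx j) h) rfl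
  refine ⟨j, bary M y i / bary M x i, div_pos (hM.pos hy i) hxi, ?_, hj',
    fun h => (hmem j).1 h rfl, heq⟩
  have hsy := hM.toIsLatticeFrame.sum_bary (hM.latticePoint hy)
  have hsx := hM.toIsLatticeFrame.sum_bary (hM.latticePoint hx)
  have hlt : ∑ l, bary M y i / bary M x i * bary M x l < ∑ l, bary M y l := by
    apply Finset.sum_lt_sum
    · intro l _
      by_cases hl : l = j
      · rw [hl]; exact hj'.le
      · rw [heq l hl]
    · exact ⟨j, Finset.mem_univ j, hj'⟩
  rwa [← Finset.mul_sum, hsx, hsy, mul_one] at hlt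

/-- Every facet of a tight simplex with interior lattice points spans a unimodular simplex with
one of these points. -/
theorem exists_bary_mul_det_eq_one (hM : IsTightFrame φ M A) (hA : A.Nonempty) (i : ι) :
    ∃ x ∈ A, bary M x i * |M.det| = 1 ∧ ∀ y ∈ A, bary M x i ≤ bary M y i := by
  obtain ⟨x, hx, hmin⟩ := Finset.exists_min_image A (fun x => bary M x i) hA
  refine ⟨x, hx, ?_, hmin⟩
  rw [← (hM.piece_tight hx).1 i]
  -- Let x be closest to facet i. A point y of its piece has least ratio y/x at i, where it is at
  -- least 1; so y dominates x coordinatewise, and equal sums give y = x.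
  suffices h : piece M A x i = ∅ by simp [h]
  by_contra h
  obtain ⟨y, hy⟩ := Finset.nonempty_iff_ne_empty.2 h
  obtain ⟨⟨hyx, hyA⟩, hi⟩ := mem_piece.1 hy
  apply hyx
  apply bary_injective hM.det_ne
  have hle : ∀ l ∈ Finset.univ, bary M x l ≤ bary M y l := by
    intro l _
    have h1 := (mem_ratioMin.1 hi).2 l
    have h2 : bary M x i * bary M x l ≤ bary M y l * bary M x i :=
      (mul_le_mul_of_nonneg_right (hmin y hyA) (hM.pos hx l).le).trans h1
    exact le_of_mul_le_mul_right (by linarith) (hM.pos hx i)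
  have := (Finset.sum_eq_sum_iff_of_le hle).1 (by
    rw [hM.toIsLatticeFrame.sum_bary (hM.latticePoint hx),
      hM.toIsLatticeFrame.sum_bary (hM.latticePoint hyA)])
  exact funext fun l => (this l (Finset.mem_univ l)).symm

end IsTightFrame

end LatticeFrames

/-! ### The interior lattice points of a tight simplex lie on a median -/

section TightFrames

variable {ι : Type*} [Fintype ι] [DecidableEq ι]

theorem exists_two_ne_of_four_le_card (hι : 4 ≤ Fintype.card ι) (a b : ι) :
    ∃ l l' : ι, l ≠ l' ∧ l ≠ a ∧ l ≠ b ∧ l' ≠ a ∧ l' ≠ b := by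
  have h : 1 < (({a, b} : Finset ι)ᶜ).card := by
    rw [Finset.card_compl]
    have := Finset.card_le_two (a := a) (b := b)
    omega
  obtain ⟨l, hl, l', hl', hne⟩ := Finset.one_lt_card.1 h
  simp only [Finset.mem_compl, Finset.mem_insert, Finset.mem_singleton, not_or] at hl hl'
  exact ⟨l, l', hne, hl.1, hl.2, hl'.1, hl'.2⟩

/-- The points of `A` all lie on a line through the `s`-th vertex parallel to the median. -/
def IsAxis (M : Matrix ι ι ℝ) (A : Finset (ι → ℝ)) (s : ι) : Prop :=
  ∀ y ∈ A, ∀ l l', l ≠ s → l' ≠ s → bary M y l = bary M y l'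

namespace IsTightFrame

variable {φ : (ι → ℝ) →ₗ[ℝ] ℝ} {M : Matrix ι ι ℝ} {A : Finset (ι → ℝ)}

theorem lt_one (hM : IsTightFrame φ M A) (hι : 2 ≤ Fintype.card ι) {y : ι → ℝ} (hy : y ∈ A)
    (l : ι) : bary M y l < 1 := by
  obtain ⟨j, hj⟩ := Fintype.exists_ne_of_one_lt_card hι l
  rw [← hM.toIsLatticeFrame.sum_bary (hM.latticePoint hy)]
  exact Finset.single_lt_sum hj (Finset.mem_univ l) (Finset.mem_univ j) (hM.pos hy j)
    fun k _ _ => (hM.pos hy k).le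

theorem abs_det_pos (hM : IsTightFrame φ M A) : 0 < |M.det| := abs_pos.2 hM.det_ne

theorem one_le_bary_mul_det (hM : IsTightFrame φ M A) {y : ι → ℝ} (hy : y ∈ A) (l : ι) :
    1 ≤ bary M y l * |M.det| := by
  obtain ⟨n, hn⟩ := hM.toIsLatticeFrame.exists_int_bary_mul_det (hM.latticePoint hy) l
  have := mul_pos (hM.pos hy l) hM.abs_det_pos
  rw [hn] at this ⊢
  exact_mod_cast Int.add_one_le_iff.2 (by exact_mod_cast this : (0 : ℤ) < n)

theorem bary_le_of_mul_det_eq_one (hM : IsTightFrame φ M A) {x y : ι → ℝ} {i l : ι}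
    (hxi : bary M x i * |M.det| = 1) (hy : y ∈ A) : bary M x i ≤ bary M y l := by
  have := hM.one_le_bary_mul_det hy l
  rw [← hxi] at this
  exact le_of_mul_le_mul_right this hM.abs_det_pos

/-- The i-th piece at x is unimodular, so y has integer coordinates in its frame; the exchange
formula then gives c. It is not positive because coordinates of y are below 1 and the other term is
positive. -/
theorem exists_int_sub (hM : IsTightFrame φ M A) (hι : 2 ≤ Fintype.card ι) {x y : ι → ℝ}
    (hx : x ∈ A) {i : ι} (hxi : bary M x i * |M.det| = 1) (hy : y ∈ A) (l : ι) :
    ∃ c : ℤ, c ≤ 0 ∧ bary M y l = bary M y i / bary M x i * bary M x l + c := by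
  have hi := hM.pos hx i
  have h : ∃ c : ℤ, bary M y l = bary M y i / bary M x i * bary M x l + c := by
    by_cases hl : l = i
    · exact ⟨0, by rw [hl, div_mul_cancel₀ _ hi.ne']; simp⟩
    · obtain ⟨c, hc⟩ := (hM.toIsLatticeFrame.updateRow (hM.latticePoint hx)
        hi.ne').exists_int_bary_mul_det (hM.latticePoint hy) l
      rw [abs_det_updateRow hM.det_ne hi.le, hxi, mul_one, bary_updateRow hM.det_ne hi.ne',
        replaceCoord_ne _ _ hl] at hc
      exact ⟨c, by linarith⟩
  obtain ⟨c, hc⟩ := h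
  refine ⟨c, ?_, hc⟩
  have h1 := hM.lt_one hι hy l
  have h2 : 0 < bary M y i / bary M x i * bary M x l :=
    mul_pos (div_pos (hM.pos hy i) hi) (hM.pos hx l)
  have : (c : ℝ) < 1 := by linarith
  have : c < 1 := by exact_mod_cast this
  omega

/-- The two coordinates of y differ by an integer and both lie strictly between 0 and 1. -/
theorem bary_eq_of_bary_eq (hM : IsTightFrame φ M A) (hι : 2 ≤ Fintype.card ι) {x y : ι → ℝ}
    (hx : x ∈ A) {i l l' : ι} (hxi : bary M x i * |M.det| = 1) (h : bary M x l = bary M x l')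
    (hy : y ∈ A) : bary M y l = bary M y l' := by
  obtain ⟨c, -, hc⟩ := hM.exists_int_sub hι hx hxi hy l
  obtain ⟨c', -, hc'⟩ := hM.exists_int_sub hι hx hxi hy l'
  rw [← h] at hc'
  have h1 := hM.lt_one hι hy l
  have h2 := hM.lt_one hι hy l'
  have h3 := hM.pos hy l
  have h4 := hM.pos hy l'
  have h5 : ((c - c' : ℤ) : ℝ) < 1 := by push_cast; linarith
  have h6 : (-1 : ℝ) < ((c - c' : ℤ) : ℝ) := by push_cast; linarith
  have h5' : c - c' < 1 := by exact_mod_cast h5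
  have h6' : -1 < c - c' := by exact_mod_cast h6
  have : c = c' := by omega
  rw [hc, hc', this]

/-- As the integers of `exists_int_sub` are at most 0, x/y is least at i, and also at j. Two
minimizers put x on a segment from y to a vertex, which turns out to be the one where x has its
largest coordinate, for every y. -/
theorem exists_isAxis_of_two_unit (hM : IsTightFrame φ M A) (hι : 2 ≤ Fintype.card ι)
    {x : ι → ℝ} (hx : x ∈ A) {i j : ι} (hij : i ≠ j) (hxi : bary M x i * |M.det| = 1)
    (hxj : bary M x j * |M.det| = 1) : ∃ s, IsAxis M A s := by
  obtain ⟨s, -, hs⟩ := Finset.exists_max_image Finset.univ (bary M x) ⟨i, Finset.mem_univ i⟩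
  have hxij : bary M x i = bary M x j :=
    mul_right_cancel₀ hM.abs_det_pos.ne' (hxi.trans hxj.symm)
  have hprop : ∀ y ∈ A, ∀ l, l ≠ s → bary M y l = bary M y i / bary M x i * bary M x l := by
    intro y hy
    have hi := hM.pos hx i
    by_cases hyx : y = x
    · subst hyx; intro l _; rw [div_self hi.ne', one_mul]
    have hm := div_pos (hM.pos hy i) hi
    have hyij := hM.bary_eq_of_bary_eq hι hx hxi hxij hy
    have himem : i ∈ ratioMin (bary M y) (bary M x) := by
      refine mem_ratioMin.2 ⟨hM.pos hy i, fun l => ?_⟩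
      obtain ⟨c, hc0, hc⟩ := hM.exists_int_sub hι hx hxi hy l
      have hc0 : (c : ℝ) ≤ 0 := by exact_mod_cast hc0
      have : bary M y l ≤ bary M y i / bary M x i * bary M x l := by linarith
      rw [div_mul_eq_mul_div, le_div_iff₀ hi] at this
      linarith
    have hjmem : j ∈ ratioMin (bary M y) (bary M x) :=
      mem_ratioMin_of_ratio_eq himem (hM.pos hy j) (by rw [← hyij, ← hxij])
    have hcard : (ratioMin (bary M y) (bary M x)).card ≠ 1 := by
      have := Finset.one_lt_card.2 ⟨i, himem, j, hjmem, hij⟩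
      omega
    obtain ⟨t, r, hr0, -, hrt, htmem, hr⟩ :=
      hM.exists_ratio_of_card_ne_one hy hx (Ne.symm hyx) hcard
    have hit : i ≠ t := fun h => htmem (h ▸ himem)
    have hmr : bary M y i / bary M x i * r = 1 := by
      have := hr i hit
      rw [this, div_mul_eq_mul_div, div_eq_one_iff_eq (mul_pos hr0 (hM.pos hy i)).ne', mul_comm]
    have heq : ∀ l, l ≠ t → bary M y l = bary M y i / bary M x i * bary M x l := by
      intro l hl
      rw [hr l hl, ← mul_assoc, hmr, one_mul]
    -- If t were not the maximizing index, the integer at t would be at most -1, and then y_t ≤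
    -- m·x_t - 1 ≤ m·x_s - 1 = y_s - 1 < 0, with m = y_i/x_i.
    have hst : s = t := by
      by_contra hne
      obtain ⟨c, hc0, hc⟩ := hM.exists_int_sub hι hx hxi hy t
      have hlt : bary M y t < bary M y i / bary M x i * bary M x t := by
        calc bary M y t = bary M y i / bary M x i * (r * bary M y t) := by
              rw [← mul_assoc, hmr, one_mul]
          _ < _ := mul_lt_mul_of_pos_left hrt hm
      have hc1 : (c : ℝ) < 0 := by linarith
      have hc2 : c ≤ -1 := by
        have : c < 0 := by exact_mod_cast hc1
        omega
      have hc3 : (c : ℝ) ≤ -1 := by exact_mod_cast hc2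
      have h1 := heq s hne
      have h2 := hM.lt_one hι hy s
      have h3 := hM.pos hy t
      have h4 := mul_le_mul_of_nonneg_left (hs t (Finset.mem_univ t)) hm.le
      linarith
    rw [hst]; exact heq
  -- The point z of height 1/N over facet l is, off s, a multiple of x with factor at least 1, so x
  -- cannot be higher over l than z.
  have hunit : ∀ l, l ≠ s → bary M x l = bary M x i := by
    intro l hl
    obtain ⟨z, hz, hzl, -⟩ := hM.exists_bary_mul_det_eq_one ⟨x, hx⟩ l
    have h1 := hprop z hz l hl
    have h2 : 1 ≤ bary M z i / bary M x i :=
      (one_le_div (hM.pos hx i)).2 (hM.bary_le_of_mul_det_eq_one hxi hz)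
    have h3 : bary M z l = bary M x i :=
      mul_right_cancel₀ hM.abs_det_pos.ne' (hzl.trans hxi.symm)
    have h4 := hM.bary_le_of_mul_det_eq_one hxi hx (l := l)
    have h5 := le_mul_of_one_le_left (hM.pos hx l).le h2
    linarith
  exact ⟨s, fun y hy l l' hl hl' => by
    rw [hprop y hy l hl, hprop y hy l' hl', hunit l hl, hunit l' hl']⟩

/-- If the lattice point `x` is in general position with respect to all others, a lattice point
dividing a segment from `x` forces the line of this segment to be an axis of its piece. -/
theorem exists_affine_ratio (hM : IsTightFrame φ M A) (hι : 4 ≤ Fintype.card ι)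
    (ih : ∀ (M' : Matrix ι ι ℝ) (A' : Finset (ι → ℝ)), A'.card < A.card → IsTightFrame φ M' A' →
      ∃ s, IsAxis M' A' s)
    {x y z : ι → ℝ} (hx : x ∈ A) (hy : y ∈ A) (hz : z ∈ A) (hyx : y ≠ x)
    (h1 : ∀ p ∈ A, p ≠ x → (ratioMin (bary M x) (bary M p)).card = 1)
    {t : ℝ} (ht0 : 0 < t) (ht1 : t < 1)
    (hzt : ∀ l, bary M z l = bary M x l + t * (bary M y l - bary M x l)) :
    ∃ j r c, 0 < r ∧ r < 1 ∧ ∀ l, l ≠ j → bary M y l = r * bary M x l + c := by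
  obtain ⟨j, hj⟩ := ratioMin_nonempty (fun i => (hM.pos hx i).le)
    (hM.toIsLatticeFrame.sum_bary (hM.latticePoint hx)) (fun i => (hM.pos hy i).le)
  have hxj := hM.pos hx j
  have hzx : z ≠ x := by
    rintro rfl
    apply hyx
    apply bary_injective hM.det_ne
    ext l
    have := hzt l
    have h2 : t * (bary M y l - bary M z l) = 0 := by linarith
    rcases mul_eq_zero.1 h2 with h | h
    · exact absurd h ht0.ne'
    · exact sub_eq_zero.1 h
  have hjz : j ∈ ratioMin (bary M x) (bary M z) := by
    refine mem_ratioMin.2 ⟨hxj, fun l => ?_⟩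
    rw [hzt, hzt]
    have := mul_le_mul_of_nonneg_left ((mem_ratioMin.1 hj).2 l) ht0.le
    nlinarith
  have hypiece : y ∈ piece M A x j := mem_piece.2 ⟨⟨hyx, hy⟩, hj⟩
  have hzpiece : z ∈ piece M A x j := mem_piece.2 ⟨⟨hzx, hz⟩, hjz⟩
  have hT := hM.updateRow (by omega) hx (i := j) fun p hp =>
    h1 p (mem_piece.1 hp).1.2 (mem_piece.1 hp).1.1
  obtain ⟨s, hs⟩ := ih _ _ (card_piece_lt hx j) hT
  have hsy := hs y hypiece
  have hsz := hs z hzpiece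
  have hlt := hT.lt_one (by omega) hypiece j
  have hpos := hT.pos hypiece j
  rw [bary_updateRow hM.det_ne hxj.ne'] at hsy hsz hlt hpos
  rw [replaceCoord_same] at hlt hpos
  have hsj : s = j := by
    by_contra hne
    obtain ⟨l, -, -, hlj, hls, -, -⟩ := exists_two_ne_of_four_le_card hι j s
    have e1 := hsy j l (Ne.symm hne) hls
    have e2 := hsz j l (Ne.symm hne) hls
    rw [replaceCoord_same, replaceCoord_ne _ _ hlj] at e1 e2
    rw [hzt, hzt] at e2
    have e3 : (bary M x j + t * (bary M y j - bary M x j)) / bary M x j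
        = 1 - t + t * (bary M y j / bary M x j) := by
      field_simp; ring
    rw [e3] at e2
    have e4 : bary M x l + t * (bary M y l - bary M x l)
        - (1 - t + t * (bary M y j / bary M x j)) * bary M x l
        = t * (bary M y l - bary M y j / bary M x j * bary M x l) := by ring
    rw [e4, ← e1] at e2
    linarith
  subst hsj
  obtain ⟨l₀, -, -, hl₀, -, -, -⟩ := exists_two_ne_of_four_le_card hι s s
  refine ⟨s, bary M y s / bary M x s, replaceCoord (bary M x) (bary M y) s l₀, hpos, hlt,
    fun l hl => ?_⟩
  rw [← hsy l l₀ hl hl₀, replaceCoord_ne _ _ hl]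
  ring

/-- If some p lay on a segment from x to a vertex j, the piece at p opposite j would be tight and
contain x. Its axis would make two coordinates of x agree, since off j the coordinates of x in the
piece are a fixed multiple of the old ones. -/
theorem card_ratioMin_eq_one_of_distinct (hM : IsTightFrame φ M A) (hι : 4 ≤ Fintype.card ι)
    (ih : ∀ (M' : Matrix ι ι ℝ) (A' : Finset (ι → ℝ)), A'.card < A.card → IsTightFrame φ M' A' →
      ∃ s, IsAxis M' A' s)
    {x : ι → ℝ} (hx : x ∈ A) {i : ι} (hxi : bary M x i * |M.det| = 1)
    (hdist : ∀ l l', l ≠ l' → bary M x l ≠ bary M x l') :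
    ∀ p ∈ A, p ≠ x → (ratioMin (bary M x) (bary M p)).card = 1 := by
  intro p hp hpx
  by_contra hcard
  obtain ⟨j, r, hr0, hr1, hrj, -, hr⟩ := hM.exists_ratio_of_card_ne_one hx hp hpx hcard
  -- Otherwise p would be lower over facet i than x, whose height is already the least possible.
  have hji : j = i := by
    by_contra hne
    have h1 := hr i (Ne.symm hne)
    have h2 := hM.bary_le_of_mul_det_eq_one hxi hp (l := i)
    have h3 := hM.pos hx i
    nlinarith
  subst hji
  -- A y on a segment from p to a vertex m is a combination of x and the vertices j and m with
  -- positive weights. The ratio y/x is then least at all indices but j and m: at least two of them,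
  -- but too few for the other alternative of `piece_tight`.
  have hpiece : ∀ y ∈ piece M A p j, (ratioMin (bary M p) (bary M y)).card = 1 := by
    intro y hy
    obtain ⟨⟨hyp, hyA⟩, hj⟩ := mem_piece.1 hy
    by_contra hcard'
    obtain ⟨m, q, hq0, hq1, hqm, hm, hq⟩ := hM.exists_ratio_of_card_ne_one hp hyA hyp hcard'
    have hjm : j ≠ m := fun h => hm (h ▸ hj)
    obtain ⟨l, l', hne, hlj, hlm, hlj', hlm'⟩ := exists_two_ne_of_four_le_card hι j m
    have hyl : ∀ l, l ≠ j → l ≠ m → bary M y l = q * r * bary M x l := by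
      intro l h1 h2
      rw [hq l h2, hr l h1, mul_assoc]
    have hyj : q * r * bary M x j < bary M y j := by
      rw [hq j hjm, mul_assoc]
      exact mul_lt_mul_of_pos_left hrj hq0
    have hym : q * r * bary M x m < bary M y m := by
      rw [mul_assoc, ← hr m hjm.symm]; exact hqm
    have hqr : q * r < 1 := mul_lt_one_of_nonneg_of_lt_one_left hq0.le hq1 hr1.le
    have hyx : y ≠ x := by
      rintro rfl
      have := hyl l hlj hlm
      have := hM.pos hyA l
      nlinarith
    have hmem : ∀ l, l ≠ j → l ≠ m → l ∈ ratioMin (bary M x) (bary M y) := by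
      intro l h1 h2
      refine mem_ratioMin.2 ⟨hM.pos hx l, fun k => ?_⟩
      rw [hyl l h1 h2]
      have hk : q * r * bary M x k ≤ bary M y k := by
        by_cases hkj : k = j
        · rw [hkj]; exact hyj.le
        by_cases hkm : k = m
        · rw [hkm]; exact hym.le
        · exact (hyl k hkj hkm).ge
      nlinarith [mul_le_mul_of_nonneg_right hk (hM.pos hx l).le]
    have hc1 : (ratioMin (bary M x) (bary M y)).card ≠ 1 := by
      have := Finset.one_lt_card.2 ⟨l, hmem l hlj hlm, l', hmem l' hlj' hlm', hne⟩
      omega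
    obtain ⟨u, ρ, -, -, -, -, hρ⟩ := hM.exists_ratio_of_card_ne_one hx hyA hyx hc1
    have hρ' : ∃ l, l ≠ j ∧ l ≠ m ∧ l ≠ u := by
      by_cases h : l = u
      · exact ⟨l', hlj', hlm', fun h' => hne (h.trans h'.symm)⟩
      · exact ⟨l, hlj, hlm, h⟩
    obtain ⟨k, hkj, hkm, hku⟩ := hρ'
    have hρqr : ρ = q * r := by
      have := (hρ k hku).symm.trans (hyl k hkj hkm)
      exact mul_right_cancel₀ (hM.pos hx k).ne' this
    rw [hρqr] at hρ
    by_cases hju : j = u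
    · have := hρ m (by rintro rfl; exact hjm hju)
      linarith
    · have := hρ j hju
      linarith
  have hT := hM.updateRow (by omega) hp hpiece
  obtain ⟨s, hs⟩ := ih _ _ (card_piece_lt hp j) hT
  have hxpiece : x ∈ piece M A p j := by
    refine mem_piece.2 ⟨⟨Ne.symm hpx, hx⟩, mem_ratioMin.2 ⟨hM.pos hp j, fun l => ?_⟩⟩
    by_cases hl : l = j
    · rw [hl]
    · rw [hr l hl]
      nlinarith [mul_le_mul_of_nonneg_left hrj.le (hM.pos hx l).le]
  obtain ⟨l, l', hne, hlj, hls, hlj', hls'⟩ := exists_two_ne_of_four_le_card hι j s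
  have h1 := hs x hxpiece l l' hls hls'
  rw [bary_updateRow hM.det_ne (hM.pos hp j).ne', replaceCoord_ne _ _ hlj,
    replaceCoord_ne _ _ hlj', hr l hlj, hr l' hlj'] at h1
  -- The scaling factor 1 - r·x_j/p_j is nonzero, so equal coordinates in the piece come from equal
  -- coordinates of x.
  have h2 : bary M x j / bary M p j * r < 1 := by
    rw [div_mul_eq_mul_div, div_lt_one (hM.pos hp j)]
    linarith
  apply hdist l l' hne
  have h3 : (1 - bary M x j / bary M p j * r) * (bary M x l - bary M x l') = 0 := by linarith
  rcases mul_eq_zero.1 h3 with h | h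
  · linarith
  · exact sub_eq_zero.1 h

/-- All pieces at x and at y are tight, so their normalized volumes N·x_l and N·y_l are 1 modulo D,
where D is the dimension. Hence N(y-x)/D is integral; as N is also 1 modulo D, so is (y-x)/D. -/
theorem exists_dividing_point (hM : IsTightFrame φ M A) (hι : 4 ≤ Fintype.card ι)
    {x y : ι → ℝ} (hx : x ∈ A) (hy : y ∈ A)
    (hx1 : ∀ p ∈ A, p ≠ x → (ratioMin (bary M x) (bary M p)).card = 1)
    (hy1 : ∀ p ∈ A, p ≠ y → (ratioMin (bary M y) (bary M p)).card = 1) :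
    ∃ z ∈ A, ∃ t : ℝ, 0 < t ∧ t < 1 ∧
      ∀ l, bary M z l = bary M x l + t * (bary M y l - bary M x l) := by
  obtain ⟨D, hD⟩ : ∃ D : ℕ, Fintype.card ι = D + 1 := ⟨Fintype.card ι - 1, by omega⟩
  have hD3 : 3 ≤ D := by omega
  have hDr : (3 : ℝ) ≤ D := by exact_mod_cast hD3
  have hcard : (Fintype.card ι : ℝ) - 1 = D := by rw [hD]; push_cast; ring
  have hmod : ∀ w ∈ A, (∀ p ∈ A, p ≠ w → (ratioMin (bary M w) (bary M p)).card = 1) →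
      ∀ l, bary M w l * |M.det| = 1 + D * (piece M A w l).card := by
    intro w hw hw1 l
    have := (hM.updateRow (by omega) hw (i := l) fun p hp =>
      hw1 p (mem_piece.1 hp).1.2 (mem_piece.1 hp).1.1).det_eq
    rwa [abs_det_updateRow hM.det_ne (hM.pos hw l).le, hcard] at this
  have hNx := hmod x hx hx1
  have hNy := hmod y hy hy1
  have hN := hM.det_eq
  rw [hcard] at hN
  set n : ι → ℤ := fun l => (piece M A y l).card - (piece M A x l).card with hn
  have hdiff : ∀ l, |M.det| * (bary M y l - bary M x l) = D * n l := by
    intro l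
    rw [hn]; push_cast
    linarith [hNx l, hNy l]
  have hD0 : (D : ℝ) ≠ 0 := by positivity
  set z : ι → ℝ := ∑ l, (bary M x l + (1 / (D : ℝ)) * (bary M y l - bary M x l)) • M l with hz
  have hzb : bary M z = fun l => bary M x l + (1 / (D : ℝ)) * (bary M y l - bary M x l) :=
    bary_sum_smul hM.det_ne _
  -- From N = 1 + D·|A| one gets (y-x)/D = N(y-x)/D - |A|(y-x), and both terms on the right are
  -- integral.
  have hz2 : z = x + (∑ l, (n l : ℝ) • M l - (A.card : ℝ) • (y - x)) := by
    have e1 : ∀ l, (n l : ℝ) = |M.det| / D * (bary M y l - bary M x l) := by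
      intro l
      rw [div_mul_eq_mul_div, hdiff l]; field_simp
    have e2 : (∑ l, (n l : ℝ) • M l) = (|M.det| / D) • (y - x) := by
      simp_rw [e1, ← smul_smul, ← Finset.smul_sum, sub_smul, Finset.sum_sub_distrib,
        sum_bary_smul hM.det_ne]
    have e3 : z = x + (1 / (D : ℝ)) • (y - x) := by
      simp_rw [hz, add_smul, ← smul_smul, Finset.sum_add_distrib, ← Finset.smul_sum, sub_smul,
        Finset.sum_sub_distrib, sum_bary_smul hM.det_ne]
    rw [e2, e3, ← sub_smul, hN]
    congr 2
    field_simp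
    ring
  have hzl : IsLatticePoint φ z := by
    refine ⟨fun i => ?_, ?_⟩
    · choose m hm using fun l => (hM.row l).1 i
      obtain ⟨a, ha⟩ := (hM.latticePoint hx).1 i
      obtain ⟨b, hb⟩ := (hM.latticePoint hy).1 i
      refine ⟨a + (∑ l, n l * m l - A.card * (b - a)), ?_⟩
      rw [hz2]
      simp [hm, ha, hb, Finset.sum_apply]
    · have hs := hM.toIsLatticeFrame.sum_bary (hM.latticePoint hx)
      have hs' := hM.toIsLatticeFrame.sum_bary (hM.latticePoint hy)
      rw [← _root_.sum_bary hM.det_ne (fun i => (hM.row i).2), hzb, Finset.sum_add_distrib,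
        ← Finset.mul_sum, Finset.sum_sub_distrib, hs, hs']
      ring
  have ht0 : 0 < 1 / (D : ℝ) := by positivity
  have ht1 : 1 / (D : ℝ) < 1 := by rw [div_lt_one (by positivity)]; linarith
  refine ⟨z, (hM.mem_iff z).2 ⟨hzl, fun l => ?_⟩, 1 / (D : ℝ), ht0, ht1, fun l => by rw [hzb]⟩
  rw [hzb]
  have := hM.pos hx l
  have := hM.pos hy l
  nlinarith [mul_pos ht0 (hM.pos hy l), mul_pos (sub_pos.2 ht1) (hM.pos hx l)]

/-- Strong induction on the number of points. If no point has height 1/N over two facets, points x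
and y at that height over different facets yield contracting affine relations in both directions,
whose composition cannot separate two coordinates of x. -/
theorem exists_isAxis (hι : 4 ≤ Fintype.card ι) (hM : IsTightFrame φ M A) :
    ∃ s, IsAxis M A s := by
  induction hn : A.card using Nat.strong_induction_on generalizing M A with
  | _ n ih =>
  subst hn
  have ih' : ∀ (M' : Matrix ι ι ℝ) (A' : Finset (ι → ℝ)), A'.card < A.card →
      IsTightFrame φ M' A' → ∃ s, IsAxis M' A' s := fun M' A' h hT => ih _ h hT rfl
  have hι' : 1 < Fintype.card ι := by omega
  obtain ⟨i₁, i₂, hi⟩ := Fintype.one_lt_card_iff.1 hι'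
  rcases A.eq_empty_or_nonempty with rfl | hA
  · exact ⟨i₁, fun y hy => by simp at hy⟩
  by_cases hex : ∃ x ∈ A, ∃ i j, i ≠ j ∧ bary M x i * |M.det| = 1 ∧ bary M x j * |M.det| = 1
  · obtain ⟨x, hx, i, j, hij, hxi, hxj⟩ := hex
    exact hM.exists_isAxis_of_two_unit (by omega) hx hij hxi hxj
  exfalso
  push Not at hex
  -- A coincidence of coordinates l and l' of x passes to the point of height 1/N over facet l,
  -- which would then have this height over two facets.
  have hdist : ∀ x ∈ A, ∀ i, bary M x i * |M.det| = 1 →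
      ∀ l l', l ≠ l' → bary M x l ≠ bary M x l' := by
    intro x hx i hxi l l' hl h
    obtain ⟨y, hy, hyl, -⟩ := hM.exists_bary_mul_det_eq_one hA l
    refine hex y hy l l' hl hyl ?_
    rw [← hM.bary_eq_of_bary_eq (by omega) hx hxi h hy, hyl]
  obtain ⟨x, hx, hx1, -⟩ := hM.exists_bary_mul_det_eq_one hA i₁
  obtain ⟨y, hy, hy1, -⟩ := hM.exists_bary_mul_det_eq_one hA i₂
  have hyx : y ≠ x := by
    rintro rfl
    exact hex y hy i₁ i₂ hi hx1 hy1
  have hgx := hM.card_ratioMin_eq_one_of_distinct hι ih' hx hx1 (hdist x hx i₁ hx1)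
  have hgy := hM.card_ratioMin_eq_one_of_distinct hι ih' hy hy1 (hdist y hy i₂ hy1)
  obtain ⟨z, hz, t, ht0, ht1, hzt⟩ := hM.exists_dividing_point hι hx hy hgx hgy
  obtain ⟨z', hz', t', ht0', ht1', hzt'⟩ := hM.exists_dividing_point hι hy hx hgy hgx
  obtain ⟨j, r, c, hr0, hr1, hr⟩ :=
    hM.exists_affine_ratio hι ih' hx hy hz hyx hgx ht0 ht1 hzt
  obtain ⟨j', r', c', hr0', hr1', hr'⟩ :=
    hM.exists_affine_ratio hι ih' hy hx hz' hyx.symm hgy ht0' ht1' hzt'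
  obtain ⟨l, l', hne, hlj, hlj', hl'j, hl'j'⟩ := exists_two_ne_of_four_le_card hι j j'
  apply hdist x hx i₁ hx1 l l' hne
  have hrr : r' * r < 1 := mul_lt_one_of_nonneg_of_lt_one_left hr0'.le hr1' hr1.le
  have h1 := hr' l hlj'
  have h2 := hr' l' hl'j'
  rw [hr l hlj] at h1
  rw [hr l' hl'j] at h2
  have h3 : (1 - r' * r) * (bary M x l - bary M x l') = 0 := by linarith
  rcases mul_eq_zero.1 h3 with h | h
  · linarith
  · exact sub_eq_zero.1 h

end IsTightFrame

end TightFrames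

/-! ### Volume of the standard corner simplex -/

section Volume

open MeasureTheory

/-- The volume of a corner of the cube. -/
theorem volume_corner (d : ℕ) : ∀ t : ℝ, 0 ≤ t →
    volume {x : Fin d → ℝ | (∀ i, 0 ≤ x i) ∧ ∑ i, x i ≤ t}
      = ENNReal.ofReal (t ^ d / d.factorial) := by
  induction d with
  | zero =>
    intro t ht
    have : {x : Fin 0 → ℝ | (∀ i, 0 ≤ x i) ∧ ∑ i, x i ≤ t} = Set.univ := by
      ext x; simp [ht]
    rw [this, volume_pi, Measure.pi_of_empty (fun _ : Fin 0 => (volume : Measure ℝ)) default]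
    simp
  | succ d ih =>
    intro t ht
    set S : Set (ℝ × (Fin d → ℝ)) :=
      {q | 0 ≤ q.1 ∧ (∀ i, 0 ≤ q.2 i) ∧ q.1 + ∑ i, q.2 i ≤ t} with hS
    have hSm : MeasurableSet S := by
      have : IsClosed S := by
        have e : S = {q | 0 ≤ q.1} ∩ ({q | ∀ i, 0 ≤ q.2 i} ∩ {q | q.1 + ∑ i, q.2 i ≤ t}) := rfl
        rw [e]
        refine (isClosed_le (by fun_prop) (by fun_prop)).inter (IsClosed.inter ?_
          (isClosed_le (by fun_prop) (by fun_prop)))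
        simp only [Set.ofPred_forall]
        exact isClosed_iInter fun i => isClosed_le (by fun_prop) (by fun_prop)
      exact this.measurableSet
    have hpre : {x : Fin (d + 1) → ℝ | (∀ i, 0 ≤ x i) ∧ ∑ i, x i ≤ t}
        = (MeasurableEquiv.piFinSuccAbove (fun _ => ℝ) 0) ⁻¹' S := by
      ext x
      simp [hS, Fin.sum_univ_succ, Fin.forall_fin_succ, MeasurableEquiv.piFinSuccAbove,
        Fin.insertNthEquiv, Fin.tail, and_assoc]
    rw [hpre, (volume_preserving_piFinSuccAbove (fun _ : Fin (d + 1) => ℝ) 0).measure_preimage_equiv,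
      Measure.volume_eq_prod, Measure.prod_apply hSm]
    have hslice : ∀ a : ℝ, volume (Prod.mk a ⁻¹' S)
        = (Set.Icc 0 t).indicator (fun a => ENNReal.ofReal ((t - a) ^ d / d.factorial)) a := by
      intro a
      by_cases ha : a ∈ Set.Icc 0 t
      · rw [Set.indicator_of_mem ha, ← ih (t - a) (by linarith [ha.2])]
        congr 1
        ext y
        simp only [hS, Set.mem_preimage, Set.mem_ofPred_eq]
        constructor
        · rintro ⟨-, h1, h2⟩; exact ⟨h1, by linarith⟩
        · rintro ⟨h1, h2⟩; exact ⟨ha.1, h1, by linarith⟩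
      · rw [Set.indicator_of_notMem ha]
        convert measure_empty (μ := (volume : Measure (Fin d → ℝ)))
        ext y
        simp only [hS, Set.mem_preimage, Set.mem_ofPred_eq, Set.mem_empty_iff_false, iff_false]
        rintro ⟨h0, h1, h2⟩
        exact ha ⟨h0, by linarith [Finset.sum_nonneg fun i (_ : i ∈ Finset.univ) => h1 i]⟩
    simp_rw [hslice]
    rw [lintegral_indicator measurableSet_Icc, ← ofReal_integral_eq_lintegral_ofReal]
    · congr 1
      rw [integral_Icc_eq_integral_Ioc, ← intervalIntegral.integral_of_le ht,
        intervalIntegral.integral_div,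
        intervalIntegral.integral_comp_sub_left (fun a => a ^ d) t]
      simp only [sub_self, sub_zero, integral_pow, Nat.factorial_succ]
      push_cast
      field_simp
      simp
    · exact (Continuous.integrableOn_Icc (by fun_prop))
    · refine (ae_restrict_iff' measurableSet_Icc).2 (Filter.Eventually.of_forall fun a ha => ?_)
      have := sub_nonneg.2 ha.2
      simp only [Pi.zero_apply]
      positivity

end Volume

/-! ### Homogeneous coordinates and the volume of a simplex -/

section Homogeneous

variable {d : ℕ}

/-- Homogeneous coordinates. -/
noncomputable def homog (p : RSpace d) : Fin (d + 1) → ℝ := Fin.cons 1 fun i => p i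

/-- The matrix of homogeneous coordinates of `d + 1` points. -/
noncomputable def homogMatrix (b : Fin (d + 1) → RSpace d) :
    Matrix (Fin (d + 1)) (Fin (d + 1)) ℝ := Matrix.of fun i => homog (b i)

theorem homog_injective : Function.Injective (homog (d := d)) := by
  intro p q h
  ext i
  have := congrFun h i.succ
  simpa [homog] using this

theorem homogMatrix_row (b : Fin (d + 1) → RSpace d) (i : Fin (d + 1)) :
    homogMatrix b i = homog (b i) := rfl

/-- The linear functional that is `1` on homogeneous coordinates. -/
noncomputable abbrev leadingCoord (d : ℕ) : (Fin (d + 1) → ℝ) →ₗ[ℝ] ℝ := LinearMap.proj 0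

theorem isLatticePoint_homog {p : RSpace d} :
    IsLatticePoint (leadingCoord d) (homog p) ↔ p ∈ integerLattice d := by
  constructor
  · intro h i
    simpa [homog] using h.1 i.succ
  · intro h
    refine ⟨fun i => ?_, by simp [homog]⟩
    refine Fin.cases ⟨1, by simp [homog]⟩ (fun i => ?_) i
    simpa [homog] using h i

theorem exists_homog_eq {q : Fin (d + 1) → ℝ} (h : leadingCoord d q = 1) :
    ∃ p : RSpace d, homog p = q := by
  refine ⟨WithLp.toLp 2 fun i => q i.succ, ?_⟩
  ext i
  refine Fin.cases ?_ (fun i => ?_) i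
  · simpa [homog] using h.symm
  · simp [homog]

theorem sum_smul_homog {c : Fin (d + 1) → ℝ} (hc : ∑ i, c i = 1) (b : Fin (d + 1) → RSpace d) :
    ∑ i, c i • homogMatrix b i = homog (∑ i, c i • b i) := by
  ext j
  refine Fin.cases ?_ (fun j => ?_) j
  · simp [homogMatrix, homog, hc]
  · simp [homogMatrix, homog]

theorem det_homogMatrix_ne_zero {b : Fin (d + 1) → RSpace d} (hb : AffineIndependent ℝ b) :
    (homogMatrix b).det ≠ 0 := by
  intro h
  obtain ⟨w, hw0, hw⟩ := Matrix.exists_vecMul_eq_zero_iff.2 h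
  apply hw0
  have hw' : ∀ j, ∑ i, w i * homogMatrix b i j = 0 := fun j => congrFun hw j
  have h1 : ∑ i, w i = 0 := by simpa [homogMatrix, homog] using hw' 0
  have h2 : ∑ i, w i • b i = 0 := by
    ext j
    simpa [homogMatrix, homog] using hw' j.succ
  ext i
  exact (affineIndependent_iff.1 hb) Finset.univ w h1 h2 i (Finset.mem_univ i)

theorem bary_homog (b : AffineBasis (Fin (d + 1)) ℝ (RSpace d)) (p : RSpace d) :
    bary (homogMatrix b) (homog p) = fun i => b.coord i p := by
  apply bary_eq_of_sum (det_homogMatrix_ne_zero b.ind)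
  rw [sum_smul_homog (b.sum_coord_apply_eq_one p), b.linear_combination_coord_eq_self]

theorem det_homogMatrix (b : Fin (d + 1) → RSpace d) :
    (homogMatrix b).det = (Matrix.of fun i j : Fin d => b i.succ j - b 0 j).det := by
  set B : Matrix (Fin (d + 1)) (Fin (d + 1)) ℝ := Matrix.of fun i j =>
    homogMatrix b i j - (if i = 0 then 0 else 1) * homogMatrix b 0 j with hB
  rw [Matrix.det_eq_of_forall_row_eq_smul_add_const (B := B) (fun i => if i = 0 then 0 else 1) 0
    (by simp) (fun i j => by simp [hB]), Matrix.det_succ_column_zero, Fin.sum_univ_succ]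
  have h1 : ∀ i : Fin d, B i.succ 0 = 0 := fun i => by simp [hB, homogMatrix, homog]
  have h2 : B 0 0 = 1 := by simp [hB, homogMatrix, homog]
  simp only [h1, h2, mul_zero, zero_mul, Finset.sum_const_zero, add_zero]
  simp only [Fin.val_zero, pow_zero, one_mul]
  congr 1
  ext i j
  simp [hB, homogMatrix, homog]

-- The simplex is a translate of the linear image of the standard corner under the edge vectors at
-- `b 0`, whose determinant is that of the homogeneous matrix up to transposition.
open MeasureTheory in
theorem volume_convexHull_range (b : AffineBasis (Fin (d + 1)) ℝ (RSpace d)) :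
    volume (convexHull ℝ (Set.range b))
      = ENNReal.ofReal (|(homogMatrix b).det| / d.factorial) := by
  set B : Matrix (Fin d) (Fin d) ℝ := Matrix.of fun i j => b i.succ j - b 0 j with hB
  set S : Set (Fin d → ℝ) := {x | (∀ i, 0 ≤ x i) ∧ ∑ i, x i ≤ 1} with hS
  set f : (Fin d → ℝ) →ₗ[ℝ] (Fin d → ℝ) := Matrix.toLin' B.transpose with hf
  have hfx : ∀ x i, f x i = ∑ j, x j * (b j.succ i - b 0 i) := by
    intro x i
    simp [hf, hB, Matrix.toLin'_apply, Matrix.mulVec, dotProduct, mul_comm]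
  have hset : convexHull ℝ (Set.range b) = (MeasurableEquiv.toLp 2 (Fin d → ℝ)).symm ⁻¹'
      ((fun y => (fun i => b 0 i) + y) '' (f '' S)) := by
    rw [b.convexHull_eq_nonneg_coord]
    ext p
    simp only [Set.mem_ofPred_eq, Set.mem_preimage, Set.mem_image, exists_exists_and_eq_and]
    constructor
    · intro hp
      have hsum := b.sum_coord_apply_eq_one p
      rw [Fin.sum_univ_succ] at hsum
      refine ⟨fun j => b.coord j.succ p, ⟨fun j => hp _, by linarith [hp 0]⟩, ?_⟩
      ext i
      have hp' := congrArg (fun q : RSpace d => q i) (b.linear_combination_coord_eq_self p)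
      simp only [Fin.sum_univ_succ] at hp'
      simp only [PiLp.add_apply, PiLp.smul_apply, smul_eq_mul, WithLp.ofLp_sum,
        Finset.sum_apply, WithLp.ofLp_smul, Pi.smul_apply] at hp'
      simp only [Pi.add_apply, hfx, mul_sub, Finset.sum_sub_distrib, ← Finset.sum_mul]
      have h0 : ∑ j : Fin d, b.coord j.succ p = 1 - b.coord 0 p := by linarith
      rw [h0]
      change _ = p i
      linarith
    · rintro ⟨x, ⟨hx0, hx1⟩, hx⟩
      set c : Fin (d + 1) → ℝ := Fin.cons (1 - ∑ j, x j) x with hc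
      have hcs : ∑ i, c i = 1 := by simp [hc, Fin.sum_univ_succ]
      have hp : p = ∑ i, c i • b i := by
        ext i
        have := congrFun hx i
        simp only [Pi.add_apply, hfx] at this
        change _ = p i at this
        rw [← this, Fin.sum_univ_succ]
        simp only [hc, Fin.cons_zero, Fin.cons_succ, PiLp.add_apply, PiLp.smul_apply, smul_eq_mul,
          WithLp.ofLp_sum, Finset.sum_apply, WithLp.ofLp_smul, Pi.smul_apply, mul_sub,
          Finset.sum_sub_distrib, ← Finset.sum_mul]
        ring
      have h2 := bary_homog b p
      rw [hp, ← sum_smul_homog hcs, bary_sum_smul (det_homogMatrix_ne_zero b.ind)] at h2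
      intro i
      rw [hp, ← congrFun h2 i]
      refine Fin.cases ?_ (fun j => ?_) i
      · simpa [hc] using hx1
      · simpa [hc] using hx0 j
  rw [hset, (EuclideanSpace.volume_preserving_symm_measurableEquiv_toLp
    (Fin d)).measure_preimage_equiv, Set.image_add_left, measure_preimage_add,
    Measure.addHaar_image_linearMap, hS, volume_corner d 1 zero_le_one, hf,
    LinearMap.det_toLin', Matrix.det_transpose, det_homogMatrix, ← hB, one_pow,
    ← ENNReal.ofReal_mul (abs_nonneg _)]
  congr 1
  ring

end Homogeneous

/-! ### Vertices, facets and comparison of triangulations -/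

section Simplices

variable {d : ℕ}

theorem exists_affineBasis_of_affineIndependent {q : Fin (d + 1) → RSpace d}
    (hq : AffineIndependent ℝ q) : ∃ b : AffineBasis (Fin (d + 1)) ℝ (RSpace d), ⇑b = q :=
  ⟨⟨q, hq, hq.affineSpan_eq_top_iff_card_eq_finrank_add_one.2 (by simp)⟩, rfl⟩

theorem affineIndependent_of_det_homogMatrix_ne_zero {q : Fin (d + 1) → RSpace d}
    (h : (homogMatrix q).det ≠ 0) : AffineIndependent ℝ q := by
  rw [affineIndependent_iff]
  intro t w hw0 hw i hi
  classical
  set w' : Fin (d + 1) → ℝ := fun i => if i ∈ t then w i else 0 with hw'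
  have h0 : ∑ i, w' i • homogMatrix q i = 0 := by
    have hs : ∑ i, w' i = 0 := by simp [hw', hw0]
    have hs' : ∑ i, w' i • q i = 0 := by simp [hw', hw]
    ext j
    refine Fin.cases ?_ (fun j => ?_) j
    · simpa [homogMatrix, homog] using hs
    · simpa [homogMatrix, homog] using congrArg (fun p : RSpace d => p j) hs'
  have h1 := bary_sum_smul h w'
  have h2 := bary_sum_smul h (0 : Fin (d + 1) → ℝ)
  rw [h0] at h1
  simp only [Pi.zero_apply, zero_smul, Finset.sum_const_zero] at h2
  have := congrFun (h1.symm.trans h2) i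
  simpa [hw', hi] using this

theorem AffineBasis.coord_sum_smul (b : AffineBasis (Fin (d + 1)) ℝ (RSpace d))
    {c : Fin (d + 1) → ℝ} (hc : ∑ i, c i = 1) (q : Fin (d + 1) → RSpace d) (m : Fin (d + 1)) :
    b.coord m (∑ i, c i • q i) = ∑ i, c i * b.coord m (q i) := by
  rw [← Finset.univ.affineCombination_eq_linear_combination q c hc,
    Finset.map_affineCombination _ _ _ hc,
    Finset.univ.affineCombination_eq_linear_combination _ c hc]
  simp

/-- A family of points is an affine basis if every point has coordinates with respect to it. -/
theorem exists_affineBasis_of_coords (b : AffineBasis (Fin (d + 1)) ℝ (RSpace d))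
    (q : Fin (d + 1) → RSpace d) (c : RSpace d → Fin (d + 1) → ℝ) (h1 : ∀ p, ∑ l, c p l = 1)
    (h2 : ∀ p m, ∑ l, c p l * b.coord m (q l) = b.coord m p) :
    ∃ b' : AffineBasis (Fin (d + 1)) ℝ (RSpace d), ⇑b' = q ∧ ∀ p l, b'.coord l p = c p l := by
  have h3 : ∀ p, ∑ l, c p l • q l = p := fun p =>
    b.ext_elem fun m => by rw [b.coord_sum_smul (h1 p), h2]
  -- The coordinates of the old basis points form a matrix expressing the old frame through the new
  -- one, so the new determinant divides a nonzero one.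
  have hdet : (homogMatrix q).det ≠ 0 := by
    have : homogMatrix b = Matrix.of (fun i => c (b i)) * homogMatrix q := by
      ext i j
      have := congrFun (sum_smul_homog (h1 (b i)) q) j
      rw [h3] at this
      rw [Matrix.mul_apply, homogMatrix_row, ← this]
      simp
    have h4 := det_homogMatrix_ne_zero b.ind
    rw [this, Matrix.det_mul] at h4
    exact right_ne_zero_of_mul h4
  obtain ⟨b', hb'⟩ :=
    exists_affineBasis_of_affineIndependent (affineIndependent_of_det_homogMatrix_ne_zero hdet)
  refine ⟨b', hb', fun p l => ?_⟩
  rw [← congrFun (bary_homog b' p) l, hb']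
  refine congrFun (bary_eq_of_sum hdet ?_) l
  rw [sum_smul_homog (h1 p), h3]

theorem polyVertices_convexHull_range (b : AffineBasis (Fin (d + 1)) ℝ (RSpace d)) :
    polyVertices (convexHull ℝ (Set.range b)) = Set.range b := by
  refine Set.Subset.antisymm extremePoints_convexHull_subset ?_
  rintro _ ⟨i, rfl⟩
  refine mem_extremePoints_iff_left.2 ⟨subset_convexHull ℝ _ ⟨i, rfl⟩, ?_⟩
  intro x hx y hy hxy
  rw [b.convexHull_eq_nonneg_coord] at hx hy
  obtain ⟨α, β, hα, hβ, hαβ, h⟩ := hxy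
  have hzero : ∀ l, l ≠ i → b.coord l x = 0 := by
    intro l hl
    have h1 := congrArg (b.coord l) h
    rw [b.coord_apply_ne hl, Convex.combo_affine_apply hαβ] at h1
    simp only [smul_eq_mul] at h1
    have h2 := mul_nonneg hα.le (hx l)
    have h3 := mul_nonneg hβ.le (hy l)
    have h4 : α * b.coord l x = 0 := by linarith
    exact (mul_eq_zero.1 h4).resolve_left hα.ne'
  refine b.ext_elem fun l => ?_
  by_cases hl : l = i
  · subst hl
    have := b.sum_coord_apply_eq_one x
    rw [Finset.sum_eq_single l (fun m _ hm => hzero m hm) (by simp)] at this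
    rw [this, b.coord_apply_eq]
  · rw [hzero l hl, b.coord_apply_ne hl]

theorem subset_polyVertices_convexHull (b : AffineBasis (Fin (d + 1)) ℝ (RSpace d))
    {X : Set (RSpace d)} (hX : X ⊆ Set.range b) : X ⊆ polyVertices (convexHull ℝ X) := by
  intro x hx
  apply inter_extremePoints_subset_extremePoints_of_subset (convexHull_mono hX)
  refine ⟨subset_convexHull ℝ _ hx, ?_⟩
  have := hX hx
  rwa [← polyVertices_convexHull_range b] at this

theorem isFullSimplex_convexHull_range (b : AffineBasis (Fin (d + 1)) ℝ (RSpace d)) :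
    IsFullSimplex (convexHull ℝ (Set.range b)) := by
  classical
  refine ⟨Finset.univ.image b, ?_, ?_, by simp⟩
  · rw [Finset.card_image_of_injective _ b.ind.injective, Finset.card_univ, Fintype.card_fin]
  · have h := b.ind.range
    have e : ((Finset.univ.image b : Finset (RSpace d)) : Set (RSpace d)) = Set.range b := by simp
    exact (affineIndependent_equiv (Equiv.setCongr e.symm)).1 h

theorem IsFullSimplex.exists_affineBasis {S : Set (RSpace d)} (hS : IsFullSimplex S) :
    ∃ b : AffineBasis (Fin (d + 1)) ℝ (RSpace d), S = convexHull ℝ (Set.range b) := by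
  obtain ⟨V, hV, hind, rfl⟩ := hS
  let e : Fin (d + 1) ≃ V := (Fintype.equivFinOfCardEq (by simpa using hV)).symm
  obtain ⟨b, hb⟩ := exists_affineBasis_of_affineIndependent
    (hind.comp_embedding e.toEmbedding)
  refine ⟨b, ?_⟩
  rw [hb]
  congr 1
  ext x
  constructor
  · intro hx; exact ⟨e.symm ⟨x, hx⟩, by simp⟩
  · rintro ⟨i, rfl⟩; exact (e i).2

/-- Affinely independent points are recovered as the extreme points of their hull. This reduces the
question which simplices share a facet to a comparison of finite vertex sets. -/
theorem isSimplexFacet_subset {F S X : Set (RSpace d)} (h : IsSimplexFacet F S)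
    (b : AffineBasis (Fin (d + 1)) ℝ (RSpace d)) (hX : X ⊆ Set.range b)
    (hF : F = convexHull ℝ X) : X ⊆ polyVertices S := by
  obtain ⟨x, -, hx⟩ := h
  calc X ⊆ polyVertices (convexHull ℝ X) := subset_polyVertices_convexHull b hX
    _ = (convexHull ℝ (polyVertices S \ {x})).extremePoints ℝ := by rw [← hF, hx]; rfl
    _ ⊆ polyVertices S \ {x} := extremePoints_convexHull_subset
    _ ⊆ polyVertices S := Set.sdiff_subset

theorem subset_frontier_of_coord_eq_zero (b : AffineBasis (Fin (d + 1)) ℝ (RSpace d))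
    {X : Set (RSpace d)} (hX : X ⊆ convexHull ℝ (Set.range b)) {l : Fin (d + 1)}
    (hl : ∀ p ∈ X, b.coord l p = 0) :
    convexHull ℝ X ⊆ frontier (convexHull ℝ (Set.range b)) := by
  intro p hp
  have h1 : p ∈ convexHull ℝ (Set.range b) := convexHull_min hX (convex_convexHull ℝ _) hp
  have h2 : b.coord l p = 0 := by
    have hc : Convex ℝ (b.coord l ⁻¹' {0}) := (convex_singleton 0).affine_preimage _
    exact convexHull_min (s := X) (fun q hq => hl q hq) hc hp
  refine ⟨subset_closure h1, fun h3 => ?_⟩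
  rw [b.interior_convexHull] at h3
  exact (h3 l).ne' h2

theorem subset_closure_interior_convexHull_range (b : AffineBasis (Fin (d + 1)) ℝ (RSpace d)) :
    convexHull ℝ (Set.range b) ⊆ closure (interior (convexHull ℝ (Set.range b))) := by
  rw [(convex_convexHull ℝ _).closure_interior_eq_closure_of_nonempty_interior
    ⟨_, b.centroid_mem_interior_convexHull⟩]
  exact subset_closure

/-- A triangulation contained in a family of simplices with disjoint interiors that covers no more
than the triangulation does is the whole family. -/
theorem IsTriangulation.eq_of_subset {A : Set (RSpace d)} {𝒯 E : Set (Set (RSpace d))}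
    (h𝒯 : IsTriangulation A 𝒯) (hsub : 𝒯 ⊆ E) (hE : IsTriangulation A E) : 𝒯 = E := by
  refine Set.Subset.antisymm hsub fun S hS => ?_
  by_contra hS𝒯
  obtain ⟨b, hb⟩ := (hE.simplex S hS).exists_affineBasis
  -- The centroid of an omitted simplex must be covered by some S' in 𝒯. As S' is in the closure of
  -- its interior, the interiors of S and S' would meet.
  have hp : Finset.univ.centroid ℝ b ∈ interior S := by
    rw [hb]; exact b.centroid_mem_interior_convexHull
  have hpT : Finset.univ.centroid ℝ b ∈ ⋃ S ∈ 𝒯, S := by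
    rw [h𝒯.union_simplices, ← hE.union_simplices]
    exact Set.mem_biUnion hS (interior_subset hp)
  obtain ⟨S', hS', hpS'⟩ := Set.mem_iUnion₂.1 hpT
  obtain ⟨b', hb'⟩ := (h𝒯.simplex S' hS').exists_affineBasis
  have hcl : Finset.univ.centroid ℝ b ∈ closure (interior S') := by
    rw [hb'] at hpS' ⊢
    exact subset_closure_interior_convexHull_range b' hpS'
  obtain ⟨q, hq, hq'⟩ := mem_closure_iff.1 hcl _ isOpen_interior hp
  exact Set.disjoint_left.1 (hE.interiors_disjoint S hS S' (hsub hS')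
    (fun h => hS𝒯 (h ▸ hS'))) hq hq'

end Simplices

/-! ### Coordinates of the simplices spanned by a chain on a median -/

section Chain

variable {d : ℕ}

/-- The points `W 0, …, W k` are evenly spaced on the median from the `s`-th vertex of a simplex,
with step such that `W k` is at barycentric distance `1 / (d * k + 1)` from the opposite facet. -/
def IsMedianChain (b : AffineBasis (Fin (d + 1)) ℝ (RSpace d)) (s : Fin (d + 1)) (k : ℕ)
    (W : ℕ → RSpace d) : Prop :=
  ∀ i ≤ k, ∀ l, l ≠ s → b.coord l (W i) = i / ((d : ℝ) * k + 1)

/-- The vertices of the `i`-th simplex of a chain that misses the vertex `b j`. -/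
def sideVertices (b : AffineBasis (Fin (d + 1)) ℝ (RSpace d)) (s : Fin (d + 1))
    (W : ℕ → RSpace d) (i : ℕ) (j : Fin (d + 1)) : Set (RSpace d) :=
  {p | (p = W i ∨ p = W (i - 1)) ∨ ∃ l, l ≠ s ∧ l ≠ j ∧ p = b l}

/-- The vertices of the last simplex of a chain. -/
def lastVertices (b : AffineBasis (Fin (d + 1)) ℝ (RSpace d)) (s : Fin (d + 1)) (k : ℕ)
    (W : ℕ → RSpace d) : Set (RSpace d) :=
  {p | p = W k ∨ ∃ l, l ≠ s ∧ p = b l}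

/-- The points of a chain together with the vertices of the simplex. -/
def chainPoints (b : AffineBasis (Fin (d + 1)) ℝ (RSpace d)) (s : Fin (d + 1)) (k : ℕ)
    (W : ℕ → RSpace d) : Set (RSpace d) :=
  {p | (∃ i ≤ k, p = W i) ∨ ∃ l, l ≠ s ∧ p = b l}

/-- The simplices spanned by a chain. -/
def chainFamily (b : AffineBasis (Fin (d + 1)) ℝ (RSpace d)) (s : Fin (d + 1)) (k : ℕ)
    (W : ℕ → RSpace d) : Set (Set (RSpace d)) :=
  {S | ∃ i j, 1 ≤ i ∧ i ≤ k ∧ j ≠ s ∧ S = convexHull ℝ (sideVertices b s W i j)} ∪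
    {convexHull ℝ (lastVertices b s k W)}

namespace IsMedianChain

variable {b : AffineBasis (Fin (d + 1)) ℝ (RSpace d)} {s : Fin (d + 1)} {k : ℕ}
  {W : ℕ → RSpace d}

theorem denom_pos : (0 : ℝ) < (d : ℝ) * k + 1 := by positivity

theorem coord_apex (h : IsMedianChain b s k W) {i : ℕ} (hi : i ≤ k) :
    b.coord s (W i) = 1 - d * (i / ((d : ℝ) * k + 1)) := by
  have := b.sum_coord_apply_eq_one (W i)
  rw [← Finset.add_sum_erase _ _ (Finset.mem_univ s),
    Finset.sum_congr rfl fun l hl => h i hi l (Finset.ne_of_mem_erase hl), Finset.sum_const,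
    Finset.card_erase_of_mem (Finset.mem_univ s), Finset.card_univ, Fintype.card_fin,
    nsmul_eq_mul, Nat.add_sub_cancel] at this
  linarith

theorem apply_zero (h : IsMedianChain b s k W) : W 0 = b s := by
  refine b.ext_elem fun l => ?_
  by_cases hl : l = s
  · subst hl; rw [h.coord_apex (Nat.zero_le k), b.coord_apply_eq]; simp
  · rw [h 0 (Nat.zero_le k) l hl, b.coord_apply_ne hl]; simp

theorem injOn (h : IsMedianChain b s k W) (hd : 1 ≤ d) {i i' : ℕ} (hi : i ≤ k) (hi' : i' ≤ k)
    (heq : W i = W i') : i = i' := by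
  have : Nontrivial (Fin (d + 1)) := Fin.nontrivial_iff_two_le.2 (by omega)
  obtain ⟨l, hl⟩ := exists_ne s
  have h1 := h i hi l hl
  rw [heq, h i' hi' l hl, div_left_inj' denom_pos.ne'] at h1
  exact_mod_cast h1.symm

theorem ne_vertex (h : IsMedianChain b s k W) (hd : 1 ≤ d) {i : ℕ} (hi : i ≤ k) {l : Fin (d + 1)}
    (hl : l ≠ s) : W i ≠ b l := by
  intro heq
  have h1 := h i hi l hl
  rw [heq, b.coord_apply_eq, eq_div_iff denom_pos.ne', one_mul] at h1
  have h2 : d * k + 1 = i := by exact_mod_cast h1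
  nlinarith

/-- The coordinate functions of a side simplex. -/
theorem exists_sideBasis (h : IsMedianChain b s k W) {i : ℕ} (hi1 : 1 ≤ i) (hi : i ≤ k)
    {j : Fin (d + 1)} (hj : j ≠ s) :
    ∃ b' : AffineBasis (Fin (d + 1)) ℝ (RSpace d),
      Set.range b' = sideVertices b s W i j ∧ ∀ p,
        b'.coord s p = (b.coord s p + d * b.coord j p) * i - (d * k + 1) * b.coord j p ∧
        b'.coord j p = (d * k + 1) * b.coord j p - (b.coord s p + d * b.coord j p) * (i - 1) ∧
        ∀ l, l ≠ s → l ≠ j → b'.coord l p = b.coord l p - b.coord j p := by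
  set q : Fin (d + 1) → RSpace d := fun l => if l = s then W (i - 1) else if l = j then W i else b l
    with hq
  -- Slot s holds W (i-1), slot j holds W i. Coordinate j of p comes from these two alone, so `b l`
  -- gets weight p_l - p_j, and they share the total p_s + d·p_j. With weights α, β the equation
  -- α(i-1) + βi = (dk+1)p_j determines both.
  set c : RSpace d → Fin (d + 1) → ℝ := fun p l =>
    if l = s then (b.coord s p + d * b.coord j p) * i - (d * k + 1) * b.coord j p
    else if l = j then (d * k + 1) * b.coord j p - (b.coord s p + d * b.coord j p) * (i - 1)
    else b.coord l p - b.coord j p with hc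
  set R : Finset (Fin (d + 1)) := (Finset.univ.erase s).erase j with hR
  have hjm : j ∈ Finset.univ.erase s := by simp [hj]
  have hRc : (R.card : ℝ) = d - 1 := by
    rw [hR, Finset.card_erase_of_mem hjm, Finset.card_erase_of_mem (Finset.mem_univ s),
      Finset.card_univ, Fintype.card_fin, Nat.add_sub_cancel, Nat.cast_sub]
    · simp
    · by_contra hd
      have : d = 0 := by omega
      subst this
      exact hj (Subsingleton.elim (α := Fin 1) j s)
  have hmemR : ∀ l, l ∈ R ↔ l ≠ j ∧ l ≠ s := by simp [hR]
  have hsplit : ∀ f : Fin (d + 1) → ℝ, ∑ l, f l = f s + (f j + ∑ l ∈ R, f l) := by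
    intro f
    rw [← Finset.add_sum_erase _ _ (Finset.mem_univ s), ← Finset.add_sum_erase _ _ hjm]
  have hcs : ∀ p, c p s = (b.coord s p + d * b.coord j p) * i - (d * k + 1) * b.coord j p := by
    intro p; simp [hc]
  have hcj : ∀ p, c p j
      = (d * k + 1) * b.coord j p - (b.coord s p + d * b.coord j p) * (i - 1) := by
    intro p; simp [hc, hj]
  have hcl : ∀ p l, l ≠ s → l ≠ j → c p l = b.coord l p - b.coord j p := by
    intro p l h1 h2; simp [hc, h1, h2]
  have hqs : q s = W (i - 1) := by simp [hq]
  have hqj : q j = W i := by simp [hq, hj]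
  have hql : ∀ l, l ≠ s → l ≠ j → q l = b l := by
    intro l h1 h2; simp [hq, h1, h2]
  have hcast : ((i - 1 : ℕ) : ℝ) = i - 1 := by rw [Nat.cast_sub hi1]; simp
  suffices h12 : (∀ p, ∑ l, c p l = 1) ∧
      ∀ p m, ∑ l, c p l * b.coord m (q l) = b.coord m p by
    obtain ⟨b', hb', hcoord⟩ := exists_affineBasis_of_coords b q c h12.1 h12.2
    refine ⟨b', ?_, fun p => ⟨by rw [hcoord, hcs], by rw [hcoord, hcj], fun l h1 h2 => by
      rw [hcoord, hcl p l h1 h2]⟩⟩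
    rw [hb']
    ext p
    constructor
    · rintro ⟨l, rfl⟩
      by_cases hls : l = s
      · subst hls; rw [hqs]; exact Or.inl (Or.inr rfl)
      by_cases hlj : l = j
      · subst hlj; rw [hqj]; exact Or.inl (Or.inl rfl)
      · rw [hql l hls hlj]; exact Or.inr ⟨l, hls, hlj, rfl⟩
    · rintro ((rfl | rfl) | ⟨l, hls, hlj, rfl⟩)
      · exact ⟨j, hqj⟩
      · exact ⟨s, hqs⟩
      · exact ⟨l, hql l hls hlj⟩
  constructor
  · intro p
    have hs := b.sum_coord_apply_eq_one p
    rw [hsplit] at hs ⊢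
    rw [hcs, hcj, Finset.sum_congr rfl fun l hl =>
      hcl p l ((hmemR l).1 hl).2 ((hmemR l).1 hl).1, Finset.sum_sub_distrib, Finset.sum_const,
      nsmul_eq_mul, hRc]
    linarith
  · intro p m
    rw [hsplit, hcs, hcj, hqs, hqj]
    have hsum : ∑ l ∈ R, c p l * b.coord m (q l)
        = if m ∈ R then b.coord m p - b.coord j p else 0 := by
      rw [← Finset.sum_ite_eq R m fun l => b.coord l p - b.coord j p]
      refine Finset.sum_congr rfl fun l hl => ?_
      obtain ⟨hlj, hls⟩ := (hmemR l).1 hl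
      rw [hcl p l hls hlj, hql l hls hlj, b.coord_apply]
      split_ifs <;> ring
    rw [hsum]
    have hN := (denom_pos (d := d) (k := k)).ne'
    have hi' : i - 1 ≤ k := by omega
    by_cases hms : m = s
    · subst hms
      rw [if_neg (by simp [hmemR]), h.coord_apex hi', h.coord_apex hi, hcast]
      field_simp
      ring
    · rw [h _ hi' m hms, h _ hi m hms, hcast]
      by_cases hmj : m = j
      · subst hmj
        rw [if_neg (by simp [hmemR])]
        field_simp
        ring
      · rw [if_pos (by simp [hmemR, hms, hmj])]
        field_simp
        ring

/-- The coordinate functions of the last simplex. -/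
theorem exists_lastBasis (h : IsMedianChain b s k W) :
    ∃ b' : AffineBasis (Fin (d + 1)) ℝ (RSpace d),
      Set.range b' = lastVertices b s k W ∧ ∀ p,
        b'.coord s p = (d * k + 1) * b.coord s p ∧
        ∀ l, l ≠ s → b'.coord l p = b.coord l p - k * b.coord s p := by
  set q : Fin (d + 1) → RSpace d := fun l => if l = s then W k else b l with hq
  -- Only W k has a nonzero s-coordinate, namely 1/(dk+1), and its other coordinates are k times
  -- that.
  set c : RSpace d → Fin (d + 1) → ℝ := fun p l =>
    if l = s then (d * k + 1) * b.coord s p else b.coord l p - k * b.coord s p with hc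
  set R : Finset (Fin (d + 1)) := Finset.univ.erase s with hR
  have hRc : (R.card : ℝ) = d := by
    rw [hR, Finset.card_erase_of_mem (Finset.mem_univ s), Finset.card_univ, Fintype.card_fin,
      Nat.add_sub_cancel]
  have hmemR : ∀ l, l ∈ R ↔ l ≠ s := by simp [hR]
  have hsplit : ∀ f : Fin (d + 1) → ℝ, ∑ l, f l = f s + ∑ l ∈ R, f l := by
    intro f
    rw [← Finset.add_sum_erase _ _ (Finset.mem_univ s)]
  have hcs : ∀ p, c p s = (d * k + 1) * b.coord s p := by intro p; simp [hc]
  have hcl : ∀ p l, l ≠ s → c p l = b.coord l p - k * b.coord s p := by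
    intro p l h1; simp [hc, h1]
  have hqs : q s = W k := by simp [hq]
  have hql : ∀ l, l ≠ s → q l = b l := by intro l h1; simp [hq, h1]
  suffices h12 : (∀ p, ∑ l, c p l = 1) ∧
      ∀ p m, ∑ l, c p l * b.coord m (q l) = b.coord m p by
    obtain ⟨b', hb', hcoord⟩ := exists_affineBasis_of_coords b q c h12.1 h12.2
    refine ⟨b', ?_, fun p => ⟨by rw [hcoord, hcs], fun l h1 => by rw [hcoord, hcl p l h1]⟩⟩
    rw [hb']
    ext p
    constructor
    · rintro ⟨l, rfl⟩
      by_cases hls : l = s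
      · subst hls; rw [hqs]; exact Or.inl rfl
      · rw [hql l hls]; exact Or.inr ⟨l, hls, rfl⟩
    · rintro (rfl | ⟨l, hls, rfl⟩)
      · exact ⟨s, hqs⟩
      · exact ⟨l, hql l hls⟩
  constructor
  · intro p
    have hs := b.sum_coord_apply_eq_one p
    rw [hsplit] at hs ⊢
    rw [hcs, Finset.sum_congr rfl fun l hl => hcl p l ((hmemR l).1 hl), Finset.sum_sub_distrib,
      Finset.sum_const, nsmul_eq_mul, hRc]
    linarith
  · intro p m
    rw [hsplit, hcs, hqs]
    have hsum : ∑ l ∈ R, c p l * b.coord m (q l)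
        = if m ∈ R then b.coord m p - k * b.coord s p else 0 := by
      rw [← Finset.sum_ite_eq R m fun l => b.coord l p - k * b.coord s p]
      refine Finset.sum_congr rfl fun l hl => ?_
      have hls := (hmemR l).1 hl
      rw [hcl p l hls, hql l hls, b.coord_apply]
      split_ifs <;> ring
    rw [hsum]
    have hN := (denom_pos (d := d) (k := k)).ne'
    by_cases hms : m = s
    · subst hms
      rw [if_neg (by simp [hmemR]), h.coord_apex le_rfl]
      field_simp
      ring
    · rw [h _ le_rfl m hms, if_pos (by simp [hmemR, hms])]
      field_simp
      ring

theorem mem_side_iff (h : IsMedianChain b s k W) {i : ℕ} (hi1 : 1 ≤ i) (hi : i ≤ k)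
    {j : Fin (d + 1)} (hj : j ≠ s) {p : RSpace d} :
    p ∈ convexHull ℝ (sideVertices b s W i j) ↔
      (d * k + 1) * b.coord j p ≤ (b.coord s p + d * b.coord j p) * i ∧
      (b.coord s p + d * b.coord j p) * (i - 1) ≤ (d * k + 1) * b.coord j p ∧
      ∀ l, l ≠ s → l ≠ j → b.coord j p ≤ b.coord l p := by
  obtain ⟨b', hb', hc⟩ := h.exists_sideBasis hi1 hi hj
  obtain ⟨hcs, hcj, hcl⟩ := hc p
  rw [← hb', b'.convexHull_eq_nonneg_coord]
  constructor
  · intro hp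
    refine ⟨?_, ?_, fun l h1 h2 => ?_⟩
    · have := hp s; rw [hcs] at this; linarith
    · have := hp j; rw [hcj] at this; linarith
    · have := hp l; rw [hcl l h1 h2] at this; linarith
  · rintro ⟨h1, h2, h3⟩ l
    by_cases hls : l = s
    · rw [hls, hcs]; linarith
    by_cases hlj : l = j
    · rw [hlj, hcj]; linarith
    · rw [hcl l hls hlj]; linarith [h3 l hls hlj]

theorem mem_interior_side (h : IsMedianChain b s k W) {i : ℕ} (hi1 : 1 ≤ i) (hi : i ≤ k)
    {j : Fin (d + 1)} (hj : j ≠ s) {p : RSpace d}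
    (hp : p ∈ interior (convexHull ℝ (sideVertices b s W i j))) :
      (d * k + 1) * b.coord j p < (b.coord s p + d * b.coord j p) * i ∧
      (b.coord s p + d * b.coord j p) * (i - 1) < (d * k + 1) * b.coord j p ∧
      ∀ l, l ≠ s → l ≠ j → b.coord j p < b.coord l p := by
  obtain ⟨b', hb', hc⟩ := h.exists_sideBasis hi1 hi hj
  obtain ⟨hcs, hcj, hcl⟩ := hc p
  rw [← hb', b'.interior_convexHull] at hp
  refine ⟨?_, ?_, fun l h1 h2 => ?_⟩
  · have := hp s; rw [hcs] at this; linarith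
  · have := hp j; rw [hcj] at this; linarith
  · have := hp l; rw [hcl l h1 h2] at this; linarith

theorem mem_last_iff (h : IsMedianChain b s k W) {p : RSpace d} :
    p ∈ convexHull ℝ (lastVertices b s k W) ↔
      0 ≤ b.coord s p ∧ ∀ l, l ≠ s → k * b.coord s p ≤ b.coord l p := by
  obtain ⟨b', hb', hc⟩ := h.exists_lastBasis
  obtain ⟨hcs, hcl⟩ := hc p
  have hN := denom_pos (d := d) (k := k)
  rw [← hb', b'.convexHull_eq_nonneg_coord]
  constructor
  · intro hp
    refine ⟨?_, fun l h1 => ?_⟩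
    · have := hp s; rw [hcs] at this; exact nonneg_of_mul_nonneg_right this hN
    · have := hp l; rw [hcl l h1] at this; linarith
  · rintro ⟨h1, h2⟩ l
    by_cases hls : l = s
    · rw [hls, hcs]; positivity
    · rw [hcl l hls]; linarith [h2 l hls]

theorem mem_interior_last (h : IsMedianChain b s k W) {p : RSpace d}
    (hp : p ∈ interior (convexHull ℝ (lastVertices b s k W))) :
      ∀ l, l ≠ s → k * b.coord s p < b.coord l p := by
  obtain ⟨b', hb', hc⟩ := h.exists_lastBasis
  obtain ⟨hcs, hcl⟩ := hc p
  rw [← hb', b'.interior_convexHull] at hp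
  intro l hl
  have := hp l; rw [hcl l hl] at this; linarith

theorem polyVertices_side (h : IsMedianChain b s k W) {i : ℕ} (hi1 : 1 ≤ i) (hi : i ≤ k)
    {j : Fin (d + 1)} (hj : j ≠ s) :
    polyVertices (convexHull ℝ (sideVertices b s W i j)) = sideVertices b s W i j := by
  obtain ⟨b', hb', -⟩ := h.exists_sideBasis hi1 hi hj
  rw [← hb', polyVertices_convexHull_range]

theorem polyVertices_last (h : IsMedianChain b s k W) :
    polyVertices (convexHull ℝ (lastVertices b s k W)) = lastVertices b s k W := by
  obtain ⟨b', hb', -⟩ := h.exists_lastBasis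
  rw [← hb', polyVertices_convexHull_range]

theorem chain_mem_side_iff (h : IsMedianChain b s k W) (hd : 1 ≤ d) {m i : ℕ} (hm : m ≤ k)
    (hi : i ≤ k) (j : Fin (d + 1)) :
    W m ∈ sideVertices b s W i j ↔ m = i ∨ m = i - 1 := by
  constructor
  · rintro ((h1 | h1) | ⟨l, hl, -, h1⟩)
    · exact Or.inl (h.injOn hd hm hi h1)
    · exact Or.inr (h.injOn hd hm (by omega) h1)
    · exact absurd h1 (h.ne_vertex hd hm hl)
  · rintro (rfl | rfl)
    · exact Or.inl (Or.inl rfl)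
    · exact Or.inl (Or.inr rfl)

theorem vertex_mem_side_iff (h : IsMedianChain b s k W) (hd : 1 ≤ d) {i : ℕ} (hi : i ≤ k)
    (j : Fin (d + 1)) {l : Fin (d + 1)} (hl : l ≠ s) :
    b l ∈ sideVertices b s W i j ↔ l ≠ j := by
  constructor
  · rintro ((h1 | h1) | ⟨l', -, hl', h1⟩)
    · exact absurd h1.symm (h.ne_vertex hd hi hl)
    · exact absurd h1.symm (h.ne_vertex hd (by omega) hl)
    · rwa [b.ind.injective h1]
  · exact fun h1 => Or.inr ⟨l, hl, h1, rfl⟩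

theorem chain_mem_last_iff (h : IsMedianChain b s k W) (hd : 1 ≤ d) {m : ℕ} (hm : m ≤ k) :
    W m ∈ lastVertices b s k W ↔ m = k := by
  constructor
  · rintro (h1 | ⟨l, hl, h1⟩)
    · exact h.injOn hd hm le_rfl h1
    · exact absurd h1 (h.ne_vertex hd hm hl)
  · rintro rfl; exact Or.inl rfl

theorem vertex_mem_last {l : Fin (d + 1)} (hl : l ≠ s) : b l ∈ lastVertices b s k W :=
  Or.inr ⟨l, hl, rfl⟩

end IsMedianChain

end Chain

/-! ### The chain family is the unique triangulation of its points -/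

section ChainTriangulation

variable {d : ℕ}

/-- The vertices common to two neighbouring simplices that meet the chain in one point. -/
def pointRidge (b : AffineBasis (Fin (d + 1)) ℝ (RSpace d)) (s : Fin (d + 1))
    (W : ℕ → RSpace d) (m : ℕ) (j : Fin (d + 1)) : Set (RSpace d) :=
  {p | p = W m ∨ ∃ l, l ≠ s ∧ l ≠ j ∧ p = b l}

/-- The vertices common to two neighbouring simplices that meet the chain in a segment. -/
def segmentRidge (b : AffineBasis (Fin (d + 1)) ℝ (RSpace d)) (s : Fin (d + 1))
    (W : ℕ → RSpace d) (i : ℕ) (j j' : Fin (d + 1)) : Set (RSpace d) :=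
  {p | (p = W i ∨ p = W (i - 1)) ∨ ∃ l, l ≠ s ∧ l ≠ j ∧ l ≠ j' ∧ p = b l}

theorem encard_eq_two_of_facets {E : Set (Set (RSpace d))} {F S₁ S₂ : Set (RSpace d)}
    (h₁ : S₁ ∈ E) (h₂ : S₂ ∈ E) (hF₁ : IsSimplexFacet F S₁) (hF₂ : IsSimplexFacet F S₂)
    (hne : S₁ ≠ S₂) (hall : ∀ S ∈ E, IsSimplexFacet F S → S = S₁ ∨ S = S₂) :
    {S | S ∈ E ∧ IsSimplexFacet F S}.encard = 2 := by
  rw [← Set.encard_pair hne]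
  congr 1
  ext S
  constructor
  · rintro ⟨hS, hF⟩; exact hall S hS hF
  · rintro (rfl | rfl)
    exacts [⟨h₁, hF₁⟩, ⟨h₂, hF₂⟩]

namespace IsMedianChain

variable {b : AffineBasis (Fin (d + 1)) ℝ (RSpace d)} {s : Fin (d + 1)} {k : ℕ}
  {W : ℕ → RSpace d}

theorem side_sdiff_upper (h : IsMedianChain b s k W) (hd : 1 ≤ d) {i : ℕ} (hi1 : 1 ≤ i)
    (hi : i ≤ k) (j : Fin (d + 1)) :
    sideVertices b s W i j \ {W i} = pointRidge b s W (i - 1) j := by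
  ext p
  constructor
  · rintro ⟨(rfl | rfl) | hp, hne⟩
    · exact absurd rfl hne
    · exact Or.inl rfl
    · exact Or.inr hp
  · rintro (rfl | ⟨l, hl, hlj, rfl⟩)
    · refine ⟨Or.inl (Or.inr rfl), fun h1 => ?_⟩
      have := h.injOn hd (by omega) hi h1
      omega
    · exact ⟨Or.inr ⟨l, hl, hlj, rfl⟩, fun h1 => h.ne_vertex hd hi hl h1.symm⟩

theorem side_sdiff_lower (h : IsMedianChain b s k W) (hd : 1 ≤ d) {i : ℕ} (hi1 : 1 ≤ i)
    (hi : i ≤ k) (j : Fin (d + 1)) :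
    sideVertices b s W i j \ {W (i - 1)} = pointRidge b s W i j := by
  ext p
  constructor
  · rintro ⟨(rfl | rfl) | hp, hne⟩
    · exact Or.inl rfl
    · exact absurd rfl hne
    · exact Or.inr hp
  · rintro (rfl | ⟨l, hl, hlj, rfl⟩)
    · refine ⟨Or.inl (Or.inl rfl), fun h1 => ?_⟩
      have := h.injOn hd hi (by omega) h1
      omega
    · exact ⟨Or.inr ⟨l, hl, hlj, rfl⟩, fun h1 => h.ne_vertex hd (by omega) hl h1.symm⟩

theorem side_sdiff_vertex (h : IsMedianChain b s k W) (hd : 1 ≤ d) {i : ℕ}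
    (hi : i ≤ k) (j : Fin (d + 1)) {m : Fin (d + 1)} (hm : m ≠ s) :
    sideVertices b s W i j \ {b m} = segmentRidge b s W i j m := by
  ext p
  constructor
  · rintro ⟨hp | ⟨l, hl, hlj, rfl⟩, hne⟩
    · exact Or.inl hp
    · exact Or.inr ⟨l, hl, hlj, fun h1 => hne (h1 ▸ rfl), rfl⟩
  · rintro ((rfl | rfl) | ⟨l, hl, hlj, hlm, rfl⟩)
    · exact ⟨Or.inl (Or.inl rfl), fun h1 => h.ne_vertex hd hi hm h1⟩
    · exact ⟨Or.inl (Or.inr rfl), fun h1 => h.ne_vertex hd (by omega) hm h1⟩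
    · exact ⟨Or.inr ⟨l, hl, hlj, rfl⟩, fun h1 => hlm (b.ind.injective h1)⟩

theorem last_sdiff_vertex (h : IsMedianChain b s k W) (hd : 1 ≤ d) {m : Fin (d + 1)}
    (hm : m ≠ s) : lastVertices b s k W \ {b m} = pointRidge b s W k m := by
  ext p
  constructor
  · rintro ⟨hp | ⟨l, hl, rfl⟩, hne⟩
    · exact Or.inl hp
    · exact Or.inr ⟨l, hl, fun h1 => hne (h1 ▸ rfl), rfl⟩
  · rintro (rfl | ⟨l, hl, hlm, rfl⟩)
    · exact ⟨Or.inl rfl, fun h1 => h.ne_vertex hd le_rfl hm h1⟩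
    · exact ⟨Or.inr ⟨l, hl, rfl⟩, fun h1 => hlm (b.ind.injective h1)⟩

theorem segmentRidge_comm (i : ℕ) (j j' : Fin (d + 1)) :
    segmentRidge b s W i j j' = segmentRidge b s W i j' j := by
  ext p
  simp only [segmentRidge, Set.mem_ofPred_eq]
  refine or_congr_right (exists_congr fun l => ?_)
  tauto

theorem subset_vertices_of_facet (h : IsMedianChain b s k W) {S X : Set (RSpace d)}
    {i : ℕ} (hi1 : 1 ≤ i) (hi : i ≤ k) {j : Fin (d + 1)} (hj : j ≠ s)
    (hX : X ⊆ sideVertices b s W i j) (hF : IsSimplexFacet (convexHull ℝ X) S) :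
    X ⊆ polyVertices S := by
  obtain ⟨b', hb', -⟩ := h.exists_sideBasis hi1 hi hj
  exact isSimplexFacet_subset hF b' (hb' ▸ hX) rfl

theorem isSimplexFacet_side (h : IsMedianChain b s k W) {i : ℕ} (hi1 : 1 ≤ i) (hi : i ≤ k)
    {j : Fin (d + 1)} (hj : j ≠ s) {x : RSpace d} (hx : x ∈ sideVertices b s W i j) :
    IsSimplexFacet (convexHull ℝ (sideVertices b s W i j \ {x}))
      (convexHull ℝ (sideVertices b s W i j)) :=
  ⟨x, by rwa [h.polyVertices_side hi1 hi hj], by rw [h.polyVertices_side hi1 hi hj]⟩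

theorem isSimplexFacet_last (h : IsMedianChain b s k W) {x : RSpace d}
    (hx : x ∈ lastVertices b s k W) :
    IsSimplexFacet (convexHull ℝ (lastVertices b s k W \ {x}))
      (convexHull ℝ (lastVertices b s k W)) :=
  ⟨x, by rwa [h.polyVertices_last], by rw [h.polyVertices_last]⟩

theorem side_mem {i : ℕ} (hi1 : 1 ≤ i) (hi : i ≤ k) {j : Fin (d + 1)} (hj : j ≠ s) :
    convexHull ℝ (sideVertices b s W i j) ∈ chainFamily b s k W :=
  Or.inl ⟨i, j, hi1, hi, hj, rfl⟩

theorem last_mem : convexHull ℝ (lastVertices b s k W) ∈ chainFamily b s k W := Or.inr rfl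

theorem side_ne_of_mem_of_notMem (h : IsMedianChain b s k W) {i : ℕ} (hi1 : 1 ≤ i) (hi : i ≤ k)
    {j : Fin (d + 1)} (hj : j ≠ s) {S : Set (RSpace d)} {x : RSpace d} (hx : x ∈ polyVertices S)
    (hx' : x ∉ sideVertices b s W i j) : convexHull ℝ (sideVertices b s W i j) ≠ S := by
  intro heq
  rw [← heq, h.polyVertices_side hi1 hi hj] at hx
  exact hx' hx

theorem coord_chain_nonneg (h : IsMedianChain b s k W) {i : ℕ} (hi : i ≤ k) (l : Fin (d + 1)) :
    0 ≤ b.coord l (W i) := by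
  have hN := denom_pos (d := d) (k := k)
  by_cases hl : l = s
  · rw [hl, h.coord_apex hi, sub_nonneg, mul_div, div_le_one hN]
    have : (i : ℝ) ≤ k := by exact_mod_cast hi
    nlinarith [mul_le_mul_of_nonneg_left this (Nat.cast_nonneg (α := ℝ) d)]
  · rw [h i hi l hl]; positivity

theorem chainPoints_subset (h : IsMedianChain b s k W) :
    chainPoints b s k W ⊆ convexHull ℝ (Set.range b) := by
  rintro p (⟨i, hi, rfl⟩ | ⟨l, -, rfl⟩)
  · rw [b.convexHull_eq_nonneg_coord]; exact h.coord_chain_nonneg hi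
  · exact subset_convexHull ℝ _ ⟨l, rfl⟩

theorem range_subset_chainPoints (h : IsMedianChain b s k W) :
    Set.range b ⊆ chainPoints b s k W := by
  rintro _ ⟨l, rfl⟩
  by_cases hl : l = s
  · exact Or.inl ⟨0, Nat.zero_le k, by rw [h.apply_zero, hl]⟩
  · exact Or.inr ⟨l, hl, rfl⟩

theorem convexHull_chainPoints (h : IsMedianChain b s k W) :
    convexHull ℝ (chainPoints b s k W) = convexHull ℝ (Set.range b) :=
  (convexHull_min h.chainPoints_subset (convex_convexHull ℝ _)).antisymm
    (convexHull_mono h.range_subset_chainPoints)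

theorem side_subset_chainPoints {i : ℕ} (hi : i ≤ k) (j : Fin (d + 1)) :
    sideVertices b s W i j ⊆ chainPoints b s k W := by
  rintro p ((rfl | rfl) | ⟨l, hl, -, rfl⟩)
  · exact Or.inl ⟨i, hi, rfl⟩
  · exact Or.inl ⟨i - 1, by omega, rfl⟩
  · exact Or.inr ⟨l, hl, rfl⟩

theorem last_subset_chainPoints : lastVertices b s k W ⊆ chainPoints b s k W := by
  rintro p (rfl | ⟨l, hl, rfl⟩)
  · exact Or.inl ⟨k, le_rfl, rfl⟩
  · exact Or.inr ⟨l, hl, rfl⟩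

/-- For m = 0 the ridge lies in the facet of the big simplex opposite `b j`. For 0 < m < k it
separates the side simplices m and m+1 with the same j; for m = k, the side simplex k from the last
simplex. -/
theorem pointRidge_facets (h : IsMedianChain b s k W) (hd : 1 ≤ d) {m : ℕ} (hm : m ≤ k)
    {j : Fin (d + 1)} (hj : j ≠ s) :
    convexHull ℝ (pointRidge b s W m j) ⊆ frontier (convexHull ℝ (chainPoints b s k W)) ∨
    {S | S ∈ chainFamily b s k W ∧
      IsSimplexFacet (convexHull ℝ (pointRidge b s W m j)) S}.encard = 2 := by
  rcases Nat.eq_zero_or_pos m with rfl | hm1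
  · left
    rw [h.convexHull_chainPoints]
    refine subset_frontier_of_coord_eq_zero b (l := j) ?_ ?_
    · refine Set.Subset.trans ?_ h.chainPoints_subset
      rintro p (rfl | ⟨l, hl, -, rfl⟩)
      · exact Or.inl ⟨0, hm, rfl⟩
      · exact Or.inr ⟨l, hl, rfl⟩
    · rintro p (rfl | ⟨l, hl, hlj, rfl⟩)
      · rw [h 0 hm j hj]; simp
      · exact b.coord_apply_ne hlj.symm
  right
  have hup := h.side_sdiff_lower hd hm1 hm j
  have hF₁ := h.isSimplexFacet_side hm1 hm hj (x := W (m - 1)) (Or.inl (Or.inr rfl))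
  rw [hup] at hF₁
  have hsub : pointRidge b s W m j ⊆ sideVertices b s W m j := hup ▸ Set.sdiff_subset
  have hclass : ∀ i j', 1 ≤ i → i ≤ k → j' ≠ s →
      IsSimplexFacet (convexHull ℝ (pointRidge b s W m j))
        (convexHull ℝ (sideVertices b s W i j')) → j' = j ∧ (m = i ∨ m = i - 1) := by
    intro i j' hi1 hi hj' hF
    have h1 := h.subset_vertices_of_facet hm1 hm hj hsub hF
    rw [h.polyVertices_side hi1 hi hj'] at h1
    refine ⟨?_, (h.chain_mem_side_iff hd hm hi j').1 (h1 (Or.inl rfl))⟩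
    by_contra hne
    exact (h.vertex_mem_side_iff hd hi j' hj').1 (h1 (Or.inr ⟨j', hj', hne, rfl⟩)) rfl
  have hclass' : IsSimplexFacet (convexHull ℝ (pointRidge b s W m j))
      (convexHull ℝ (lastVertices b s k W)) → m = k := by
    intro hF
    have h1 := h.subset_vertices_of_facet hm1 hm hj hsub hF
    rw [h.polyVertices_last] at h1
    exact (h.chain_mem_last_iff hd hm).1 (h1 (Or.inl rfl))
  rcases hm.lt_or_eq with hlt | rfl
  · have hdown := h.side_sdiff_upper hd (Nat.succ_le_succ (Nat.zero_le m)) hlt j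
    rw [Nat.succ_eq_add_one, Nat.add_sub_cancel] at hdown
    have hF₂ := h.isSimplexFacet_side (Nat.succ_le_succ (Nat.zero_le m)) hlt hj
      (x := W (m + 1)) (Or.inl (Or.inl rfl))
    rw [Nat.succ_eq_add_one, hdown] at hF₂
    refine encard_eq_two_of_facets (side_mem hm1 hm hj) (side_mem (by omega) hlt hj) hF₁ hF₂ ?_ ?_
    · refine h.side_ne_of_mem_of_notMem hm1 hm hj (x := W (m + 1)) ?_ ?_
      · rw [h.polyVertices_side (by omega) hlt hj]; exact Or.inl (Or.inl rfl)
      · rw [h.chain_mem_side_iff hd hlt hm]; omega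
    · rintro S (⟨i, j', hi1, hi, hj', rfl⟩ | rfl) hF
      · obtain ⟨rfl, hmi⟩ := hclass i j' hi1 hi hj' hF
        rcases hmi with rfl | hmi
        · exact Or.inl rfl
        · right
          have : i = m + 1 := by omega
          rw [this]
      · have := hclass' hF
        omega
  · have hF₂ := h.isSimplexFacet_last (x := b j) (vertex_mem_last hj)
    rw [h.last_sdiff_vertex hd hj] at hF₂
    refine encard_eq_two_of_facets (side_mem hm1 hm hj) last_mem hF₁ hF₂ ?_ ?_
    · refine h.side_ne_of_mem_of_notMem hm1 hm hj (x := b j) ?_ ?_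
      · rw [h.polyVertices_last]; exact vertex_mem_last hj
      · rw [h.vertex_mem_side_iff hd hm j hj]; simp
    · rintro S (⟨i, j', hi1, hi, hj', rfl⟩ | rfl) hF
      · obtain ⟨rfl, hmi⟩ := hclass i j' hi1 hi hj' hF
        have : m = i := by omega
        rw [this]; exact Or.inl rfl
      · exact Or.inr rfl

/-- The two chain points fix the index i and exclude the last simplex; the vertices present leave
only j and m as the missing one. -/
theorem segmentRidge_facets (h : IsMedianChain b s k W) (hd : 1 ≤ d) {i : ℕ} (hi1 : 1 ≤ i)
    (hi : i ≤ k) {j m : Fin (d + 1)} (hj : j ≠ s) (hm : m ≠ s) (hmj : m ≠ j) :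
    {S | S ∈ chainFamily b s k W ∧
      IsSimplexFacet (convexHull ℝ (segmentRidge b s W i j m)) S}.encard = 2 := by
  have hF₁ := h.isSimplexFacet_side hi1 hi hj (x := b m) (Or.inr ⟨m, hm, hmj, rfl⟩)
  have hF₂ := h.isSimplexFacet_side hi1 hi hm (x := b j) (Or.inr ⟨j, hj, hmj.symm, rfl⟩)
  have hV₁ := h.side_sdiff_vertex hd hi j hm
  rw [hV₁] at hF₁
  rw [h.side_sdiff_vertex hd hi m hj, segmentRidge_comm] at hF₂
  have hsub : segmentRidge b s W i j m ⊆ sideVertices b s W i j := hV₁ ▸ Set.sdiff_subset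
  refine encard_eq_two_of_facets (side_mem hi1 hi hj) (side_mem hi1 hi hm) hF₁ hF₂ ?_ ?_
  · refine h.side_ne_of_mem_of_notMem hi1 hi hj (x := b j) ?_ ?_
    · rw [h.polyVertices_side hi1 hi hm]; exact Or.inr ⟨j, hj, hmj.symm, rfl⟩
    · rw [h.vertex_mem_side_iff hd hi j hj]; simp
  · rintro S (⟨i', t, hi1', hi', ht, rfl⟩ | rfl) hF
    · have h1 := h.subset_vertices_of_facet hi1 hi hj hsub hF
      rw [h.polyVertices_side hi1' hi' ht] at h1
      have h2 := (h.chain_mem_side_iff hd hi hi' t).1 (h1 (Or.inl (Or.inl rfl)))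
      have h3 := (h.chain_mem_side_iff hd (by omega) hi' t).1 (h1 (Or.inl (Or.inr rfl)))
      have hii : i' = i := by omega
      subst hii
      by_cases htj : t = j
      · left; rw [htj]
      by_cases htm : t = m
      · right; rw [htm]
      · exact absurd rfl ((h.vertex_mem_side_iff hd hi' t ht).1
          (h1 (Or.inr ⟨t, ht, htj, htm, rfl⟩)))
    · have h1 := h.subset_vertices_of_facet hi1 hi hj hsub hF
      rw [h.polyVertices_last] at h1
      have h2 := (h.chain_mem_last_iff hd hi).1 (h1 (Or.inl (Or.inl rfl)))
      have h3 := (h.chain_mem_last_iff hd (by omega)).1 (h1 (Or.inl (Or.inr rfl)))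
      omega

theorem facets (h : IsMedianChain b s k W) (hd : 1 ≤ d) {S F : Set (RSpace d)}
    (hS : S ∈ chainFamily b s k W) (hF : IsSimplexFacet F S) :
    F ⊆ frontier (convexHull ℝ (chainPoints b s k W)) ∨
      {S' | S' ∈ chainFamily b s k W ∧ IsSimplexFacet F S'}.encard = 2 := by
  obtain ⟨x, hx, rfl⟩ := hF
  rcases hS with ⟨i, j, hi1, hi, hj, rfl⟩ | rfl
  · rw [h.polyVertices_side hi1 hi hj] at hx ⊢
    rcases hx with (rfl | rfl) | ⟨m, hm, hmj, rfl⟩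
    · rw [h.side_sdiff_upper hd hi1 hi]
      exact h.pointRidge_facets hd (by omega) hj
    · rw [h.side_sdiff_lower hd hi1 hi]
      exact h.pointRidge_facets hd hi hj
    · rw [h.side_sdiff_vertex hd hi j hm]
      exact Or.inr (h.segmentRidge_facets hd hi1 hi hj hm hmj)
  · rw [h.polyVertices_last] at hx ⊢
    rcases hx with rfl | ⟨m, hm, rfl⟩
    · left
      rw [h.convexHull_chainPoints]
      refine subset_frontier_of_coord_eq_zero b (l := s) ?_ ?_
      · exact (Set.sdiff_subset.trans last_subset_chainPoints).trans h.chainPoints_subset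
      · rintro p ⟨rfl | ⟨l, hl, rfl⟩, hne⟩
        · exact absurd rfl hne
        · exact b.coord_apply_ne hl.symm
    · rw [h.last_sdiff_vertex hd hm]
      exact h.pointRidge_facets hd le_rfl hm

/-- An interior point of a side simplex determines it: j is the index of the strictly least
coordinate off s, and (dk+1)p_j/(p_s + d·p_j) lies strictly between i-1 and i. In the interior of
the last simplex this quotient would exceed k. -/
theorem interiors_disjoint (h : IsMedianChain b s k W) (hd : 1 ≤ d) {S S' : Set (RSpace d)}
    (hS : S ∈ chainFamily b s k W) (hS' : S' ∈ chainFamily b s k W) (hne : S ≠ S') :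
    Disjoint (interior S) (interior S') := by
  have : Nontrivial (Fin (d + 1)) := Fin.nontrivial_iff_two_le.2 (by omega)
  have hside : ∀ {i j p}, 1 ≤ i → i ≤ k → j ≠ s →
      p ∈ interior (convexHull ℝ (sideVertices b s W i j)) →
      p ∉ interior (convexHull ℝ (lastVertices b s k W)) := by
    intro i j p hi1 hi hj hp hp'
    have h1 := (h.mem_interior_side hi1 hi hj hp).1
    have h1' := (h.mem_interior_side hi1 hi hj hp).2.1
    have h2 := h.mem_interior_last hp' j hj
    have hik : (i : ℝ) ≤ k := by exact_mod_cast hi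
    have hσ : 0 ≤ b.coord s p + d * b.coord j p := by linarith
    nlinarith [mul_le_mul_of_nonneg_left hik hσ]
  rw [Set.disjoint_left]
  intro p hp hp'
  rcases hS with ⟨i, j, hi1, hi, hj, rfl⟩ | rfl <;>
    rcases hS' with ⟨i', j', hi1', hi', hj', rfl⟩ | rfl
  · obtain ⟨h1, h2, h3⟩ := h.mem_interior_side hi1 hi hj hp
    obtain ⟨h1', h2', h3'⟩ := h.mem_interior_side hi1' hi' hj' hp'
    have hjj : j = j' := by
      by_contra hjj
      exact lt_asymm (h3 j' hj' (Ne.symm hjj)) (h3' j hj hjj)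
    subst hjj
    have hσ : 0 < b.coord s p + d * b.coord j p := by linarith
    have e1 : (i : ℝ) - 1 < i' := lt_of_mul_lt_mul_left (h2.trans h1') hσ.le
    have e2 : (i' : ℝ) - 1 < i := lt_of_mul_lt_mul_left (h2'.trans h1) hσ.le
    have e1' : (i : ℝ) < ((i' + 1 : ℕ) : ℝ) := by push_cast; linarith
    have e2' : (i' : ℝ) < ((i + 1 : ℕ) : ℝ) := by push_cast; linarith
    have e3 : i < i' + 1 := by exact_mod_cast e1'
    have e4 : i' < i + 1 := by exact_mod_cast e2'
    have : i = i' := by omega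
    subst this
    exact hne rfl
  · exact hside hi1 hi hj hp hp'
  · exact hside hi1' hi' hj' hp' hp
  · exact hne rfl

theorem only_vertices (h : IsMedianChain b s k W) (hd : 2 ≤ d) {S : Set (RSpace d)}
    (hS : S ∈ chainFamily b s k W) : S ∩ chainPoints b s k W ⊆ polyVertices S := by
  have : Nontrivial (Fin (d + 1)) := Fin.nontrivial_iff_two_le.2 (by omega)
  have hN := denom_pos (d := d) (k := k)
  rintro p ⟨hpS, hp⟩
  rcases hS with ⟨i, j, hi1, hi, hj, rfl⟩ | rfl
  · rw [h.polyVertices_side hi1 hi hj]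
    obtain ⟨h1, h2, h3⟩ := (h.mem_side_iff hi1 hi hj).1 hpS
    rcases hp with ⟨m, hm, rfl⟩ | ⟨l, hl, rfl⟩
    · rw [h.chain_mem_side_iff (by omega) hm hi]
      rw [h.coord_apex hm, h m hm j hj, mul_div_cancel₀ _ hN.ne', sub_add_cancel, one_mul] at h1 h2
      have e1 : m ≤ i := by exact_mod_cast h1
      have e2 : (i : ℝ) ≤ ((m + 1 : ℕ) : ℝ) := by push_cast; linarith
      have e3 : i ≤ m + 1 := by exact_mod_cast e2
      omega
    · rw [h.vertex_mem_side_iff (by omega) hi j hl]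
      rintro rfl
      -- Here d ≥ 2 matters: a third index is needed to see that the omitted vertex is not in the
      -- simplex.
      have hc : 0 < ((({s, l} : Finset (Fin (d + 1)))ᶜ)).card := by
        rw [Finset.card_compl, Fintype.card_fin]
        have := Finset.card_le_two (a := s) (b := l)
        omega
      obtain ⟨t, ht⟩ := Finset.card_pos.1 hc
      simp only [Finset.mem_compl, Finset.mem_insert, Finset.mem_singleton, not_or] at ht
      have := h3 t ht.1 ht.2
      rw [b.coord_apply_eq, b.coord_apply_ne ht.2] at this
      linarith
  · rw [h.polyVertices_last]
    obtain ⟨h1, h2⟩ := h.mem_last_iff.1 hpS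
    rcases hp with ⟨m, hm, rfl⟩ | ⟨l, hl, rfl⟩
    · rw [h.chain_mem_last_iff (by omega) hm]
      obtain ⟨l, hl⟩ := exists_ne s
      have := h2 l hl
      rw [h.coord_apex hm, h m hm l hl, mul_sub, mul_one, ← mul_assoc] at this
      have e1 : (k : ℝ) ≤ (1 + k * d) * (m / ((d : ℝ) * k + 1)) := by linarith
      rw [mul_comm (k : ℝ), add_comm (1 : ℝ), mul_div_cancel₀ _ hN.ne'] at e1
      have e2 : k ≤ m := by exact_mod_cast e1
      omega
    · exact vertex_mem_last hl

theorem exists_mem_chainFamily (h : IsMedianChain b s k W) (hd : 1 ≤ d) {p : RSpace d}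
    (hp : ∀ l, 0 ≤ b.coord l p) : ∃ S ∈ chainFamily b s k W, p ∈ S := by
  have : Nontrivial (Fin (d + 1)) := Fin.nontrivial_iff_two_le.2 (by omega)
  obtain ⟨l₀, hl₀⟩ := exists_ne s
  obtain ⟨j, hj, hmin⟩ := Finset.exists_min_image (Finset.univ.erase s)
    (fun l => b.coord l p) ⟨l₀, by simp [hl₀]⟩
  have hj := Finset.ne_of_mem_erase hj
  have hmin : ∀ l, l ≠ s → b.coord j p ≤ b.coord l p := fun l hl => hmin l (by simp [hl])
  by_cases hk : k * b.coord s p ≤ b.coord j p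
  · exact ⟨_, last_mem, h.mem_last_iff.2 ⟨hp s, fun l hl => hk.trans (hmin l hl)⟩⟩
  push Not at hk
  set μ := b.coord j p with hμ
  have hμ0 : 0 ≤ μ := hp j
  have hs0 : 0 < b.coord s p := by
    rcases (hp s).lt_or_eq with h0 | h0
    · exact h0
    · rw [← h0, mul_zero] at hk; linarith
  set σ := b.coord s p + d * μ with hσ
  have hσ0 : 0 < σ := by positivity
  have hlt : (d * k + 1) * μ < σ * k := by rw [hσ]; linarith
  -- The real position on the chain: t = m at W m. The simplex sought lies between the integers ⌊t⌋
  -- and ⌊t⌋ + 1.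
  set t := (d * k + 1) * μ / σ with ht
  have ht0 : 0 ≤ t := by positivity
  have htk : t < k := by rw [ht, div_lt_iff₀ hσ0]; linarith
  have htσ : σ * t = (d * k + 1) * μ := by rw [ht]; field_simp
  have h1 := Nat.floor_le ht0
  have h2 := Nat.lt_floor_add_one t
  have hfk : ⌊t⌋₊ + 1 ≤ k := by
    have : (⌊t⌋₊ : ℝ) < k := h1.trans_lt htk
    exact_mod_cast this
  refine ⟨_, side_mem (i := ⌊t⌋₊ + 1) (by omega) hfk hj,
    (h.mem_side_iff (by omega) hfk hj).2 ⟨?_, ?_, fun l hl _ => hmin l hl⟩⟩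
  · rw [← hμ, ← hσ, ← htσ]
    push_cast
    exact mul_le_mul_of_nonneg_left h2.le hσ0.le
  · rw [← hμ, ← hσ, ← htσ]
    push_cast
    rw [add_sub_cancel_right]
    exact mul_le_mul_of_nonneg_left h1 hσ0.le

theorem isFullSimplex_of_mem (h : IsMedianChain b s k W) {S : Set (RSpace d)}
    (hS : S ∈ chainFamily b s k W) : IsFullSimplex S := by
  rcases hS with ⟨i, j, hi1, hi, hj, rfl⟩ | rfl
  · obtain ⟨b', hb', -⟩ := h.exists_sideBasis hi1 hi hj
    rw [← hb']; exact isFullSimplex_convexHull_range b'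
  · obtain ⟨b', hb', -⟩ := h.exists_lastBasis
    rw [← hb']; exact isFullSimplex_convexHull_range b'

theorem vertices_subset (h : IsMedianChain b s k W) {S : Set (RSpace d)}
    (hS : S ∈ chainFamily b s k W) : polyVertices S ⊆ chainPoints b s k W := by
  rcases hS with ⟨i, j, hi1, hi, hj, rfl⟩ | rfl
  · rw [h.polyVertices_side hi1 hi hj]; exact side_subset_chainPoints hi j
  · rw [h.polyVertices_last]; exact last_subset_chainPoints

theorem isTriangulation (h : IsMedianChain b s k W) (hd : 2 ≤ d) :
    IsTriangulation (chainPoints b s k W) (chainFamily b s k W) where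
  simplex _ hS := h.isFullSimplex_of_mem hS
  vertices_subset _ hS := h.vertices_subset hS
  interiors_disjoint _ hS _ hS' hne := h.interiors_disjoint (by omega) hS hS' hne
  facets _ hS _ hF := h.facets (by omega) hS hF
  only_vertices _ hS := h.only_vertices hd hS
  union_vertices := by
    refine Set.Subset.antisymm (Set.iUnion₂_subset fun S hS => h.vertices_subset hS) ?_
    have : Nontrivial (Fin (d + 1)) := Fin.nontrivial_iff_two_le.2 (by omega)
    obtain ⟨j, hj⟩ := exists_ne s
    rintro p (⟨i, hi, rfl⟩ | ⟨l, hl, rfl⟩)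
    · rcases hi.lt_or_eq with hlt | rfl
      · refine Set.mem_biUnion (side_mem (i := i + 1) (by omega) hlt hj) ?_
        rw [h.polyVertices_side (by omega) hlt hj]
        exact Or.inl (Or.inr rfl)
      · refine Set.mem_biUnion last_mem ?_
        rw [h.polyVertices_last]
        exact Or.inl rfl
    · refine Set.mem_biUnion last_mem ?_
      rw [h.polyVertices_last]
      exact vertex_mem_last hl
  union_simplices := by
    refine Set.Subset.antisymm (Set.iUnion₂_subset fun S hS => ?_) fun p hp => ?_
    · obtain ⟨b', rfl⟩ := (h.isFullSimplex_of_mem hS).exists_affineBasis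
      have := h.vertices_subset hS
      rw [polyVertices_convexHull_range] at this
      exact convexHull_mono this
    · rw [h.convexHull_chainPoints, b.convexHull_eq_nonneg_coord] at hp
      obtain ⟨S, hS, hpS⟩ := h.exists_mem_chainFamily (by omega) hp
      exact Set.mem_biUnion hS hpS

theorem mem_openSegment (h : IsMedianChain b s k W) {i m n : ℕ} (him : i < m) (hmn : m < n)
    (hn : n ≤ k) : W m ∈ openSegment ℝ (W i) (W n) := by
  have hin : (0 : ℝ) < n - i := by
    rw [sub_pos]; exact_mod_cast him.trans hmn
  have h1 : (0 : ℝ) < n - m := by rw [sub_pos]; exact_mod_cast hmn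
  have h2 : (0 : ℝ) < m - i := by rw [sub_pos]; exact_mod_cast him
  have hsum : ((n : ℝ) - m) / (n - i) + (m - i) / (n - i) = 1 := by
    field_simp; ring
  refine ⟨(n - m) / (n - i), (m - i) / (n - i), by positivity, by positivity, hsum, ?_⟩
  refine b.ext_elem fun l => ?_
  have hN := (denom_pos (d := d) (k := k)).ne'
  rw [Convex.combo_affine_apply hsum]
  simp only [smul_eq_mul]
  by_cases hl : l = s
  · rw [hl, h.coord_apex (i := i) (by omega), h.coord_apex (i := m) (by omega), h.coord_apex hn]
    field_simp; ring
  · rw [h i (by omega) l hl, h m (by omega) l hl, h _ hn l hl]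
    field_simp; ring

theorem card_side (h : IsMedianChain b s k W) {i : ℕ} (hi1 : 1 ≤ i) (hi : i ≤ k)
    {j : Fin (d + 1)} (hj : j ≠ s) : (sideVertices b s W i j).ncard = d + 1 := by
  obtain ⟨b', hb', -⟩ := h.exists_sideBasis hi1 hi hj
  rw [← hb', ← Set.image_univ, Set.ncard_image_of_injective _ b'.ind.injective, Set.ncard_univ,
    Nat.card_eq_fintype_card, Fintype.card_fin]

theorem card_last (h : IsMedianChain b s k W) : (lastVertices b s k W).ncard = d + 1 := by
  obtain ⟨b', hb', -⟩ := h.exists_lastBasis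
  rw [← hb', ← Set.image_univ, Set.ncard_image_of_injective _ b'.ind.injective, Set.ncard_univ,
    Nat.card_eq_fintype_card, Fintype.card_fin]

theorem chain_last_mem_convexHull (h : IsMedianChain b s k W) {i : ℕ} (hi : i ≤ k)
    {X : Set (RSpace d)} (hX : W i ∈ X) (hV : ∀ l, l ≠ s → b l ∈ X) :
    W k ∈ convexHull ℝ X := by
  have hN := denom_pos (d := d) (k := k)
  have hD : (0 : ℝ) < (d : ℝ) * (k - i) + 1 := by
    have : (i : ℝ) ≤ k := by exact_mod_cast hi
    have := mul_nonneg (Nat.cast_nonneg (α := ℝ) d) (sub_nonneg.2 this)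
    linarith
  have hki : (0 : ℝ) ≤ k - i := by rw [sub_nonneg]; exact_mod_cast hi
  set q : Fin (d + 1) → RSpace d := fun l => if l = s then W i else b l with hq
  -- The s-coordinate decides: it is 1/(dk+1) at W k and (d(k-i)+1)/(dk+1) at W i, so W i has weight
  -- 1/(d(k-i)+1). The other vertices share the rest equally by symmetry.
  set c : Fin (d + 1) → ℝ := fun l =>
    if l = s then 1 / ((d : ℝ) * (k - i) + 1) else (k - i) / ((d : ℝ) * (k - i) + 1) with hc
  have hsplit : ∀ f : Fin (d + 1) → ℝ, ∑ l, f l = f s + ∑ l ∈ Finset.univ.erase s, f l := by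
    intro f
    rw [← Finset.add_sum_erase _ _ (Finset.mem_univ s)]
  have hcl : ∀ l ∈ Finset.univ.erase s, c l = (k - i) / ((d : ℝ) * (k - i) + 1) := by
    intro l hl; simp [hc, Finset.ne_of_mem_erase hl]
  have hcs : ∑ l, c l = 1 := by
    rw [hsplit, Finset.sum_congr rfl hcl, Finset.sum_const,
      Finset.card_erase_of_mem (Finset.mem_univ s), Finset.card_univ, Fintype.card_fin,
      Nat.add_sub_cancel, nsmul_eq_mul]
    simp only [hc, if_true]
    field_simp
    ring
  have hW : W k = ∑ l, c l • q l := by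
    refine b.ext_elem fun m => ?_
    rw [b.coord_sum_smul hcs, hsplit]
    have hsum : ∑ l ∈ Finset.univ.erase s, c l * b.coord m (q l)
        = if m ∈ Finset.univ.erase s then (k - i) / ((d : ℝ) * (k - i) + 1) else 0 := by
      rw [← Finset.sum_ite_eq (Finset.univ.erase s) m fun _ => (k - i) / ((d : ℝ) * (k - i) + 1)]
      refine Finset.sum_congr rfl fun l hl => ?_
      rw [hcl l hl]
      simp only [hq, Finset.ne_of_mem_erase hl, if_false, b.coord_apply]
      split_ifs <;> ring
    rw [hsum]
    simp only [hc, hq, if_true]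
    have hD' := hD.ne'
    by_cases hms : m = s
    · subst hms
      rw [if_neg (by simp), h.coord_apex le_rfl, h.coord_apex hi]
      field_simp
      ring
    · rw [if_pos (by simp [hms]), h _ le_rfl m hms, h _ hi m hms]
      field_simp
      ring
  rw [hW]
  refine (convex_convexHull ℝ X).sum_mem (fun l _ => ?_) hcs fun l _ => subset_convexHull ℝ X ?_
  · simp only [hc]; split_ifs <;> positivity
  · simp only [hq]; split_ifs with hl
    · exact hX
    · exact hV l hl

/-- Every simplex with vertices among the points of a chain, and without further points of the
chain, belongs to the family. -/
theorem mem_chainFamily (h : IsMedianChain b s k W) (hd : 2 ≤ d) {S : Set (RSpace d)}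
    (hS : IsFullSimplex S) (hv : polyVertices S ⊆ chainPoints b s k W)
    (ho : S ∩ chainPoints b s k W ⊆ polyVertices S) : S ∈ chainFamily b s k W := by
  classical
  have hnt : Nontrivial (Fin (d + 1)) := Fin.nontrivial_iff_two_le.2 (by omega)
  obtain ⟨b', rfl⟩ := hS.exists_affineBasis
  set X := Set.range b' with hX
  have hpv : polyVertices (convexHull ℝ X) = X := polyVertices_convexHull_range b'
  have hext : X ⊆ (convexHull ℝ X).extremePoints ℝ := hpv.symm.subset
  rw [hpv] at hv ho
  have hXcard : X.ncard = d + 1 := by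
    rw [hX, ← Set.image_univ, Set.ncard_image_of_injective _ b'.ind.injective, Set.ncard_univ,
      Nat.card_eq_fintype_card, Fintype.card_fin]
  have hXfin : X.Finite := Set.finite_range b'
  -- A chain point strictly between two vertices would itself have to be a vertex, though it is not
  -- extreme. So at most two chain points occur, and they are consecutive.
  have hbetween : ∀ {i m n}, i < m → m < n → n ≤ k → W i ∈ X → W n ∈ X → False := by
    intro i m n him hmn hn hWi hWn
    have hseg := h.mem_openSegment him hmn hn
    have hi' := subset_convexHull ℝ X hWi
    have hn' := subset_convexHull ℝ X hWn
    have hm' : W m ∈ X := ho ⟨(convex_convexHull ℝ X).openSegment_subset hi' hn' hseg,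
      Or.inl ⟨m, by omega, rfl⟩⟩
    have := (mem_extremePoints_iff_left.1 (hext hm')).2 _ hi' _ hn' hseg
    have := h.injOn (by omega) (by omega) (by omega) this
    omega
  have hvert : ∀ p ∈ X, (∃ i ≤ k, p = W i) ∨ ∃ l, l ≠ s ∧ p = b l := fun p hp => hv hp
  have himage : ∀ (R : Finset (Fin (d + 1))) (Y : Finset (RSpace d)),
      X ⊆ ((R.image b ∪ Y : Finset (RSpace d)) : Set (RSpace d)) → d + 1 ≤ R.card + Y.card := by
    intro R Y hsub
    calc d + 1 = X.ncard := hXcard.symm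
      _ ≤ ((R.image b ∪ Y : Finset (RSpace d)) : Set (RSpace d)).ncard :=
          Set.ncard_le_ncard hsub (Finset.finite_toSet _)
      _ = (R.image b ∪ Y).card := Set.ncard_coe_finset _
      _ ≤ (R.image b).card + Y.card := Finset.card_union_le _ _
      _ ≤ R.card + Y.card := by gcongr; exact Finset.card_image_le
  have hex : ∃ i, i ≤ k ∧ W i ∈ X := by
    by_contra! hno
    have := himage (Finset.univ.erase s) ∅ fun p hp => by
      rcases hvert p hp with ⟨i, hi, rfl⟩ | ⟨l, hl, rfl⟩
      · exact absurd hp (hno i hi)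
      · simp only [Finset.union_empty, Finset.coe_image]; exact ⟨l, by simp [hl], rfl⟩
    rw [Finset.card_erase_of_mem (Finset.mem_univ s), Finset.card_univ, Fintype.card_fin] at this
    simp at this
  have hcompl : ∀ j, j ≠ s → ((Finset.univ.erase s).erase j).card = d - 1 := by
    intro j hj
    rw [Finset.card_erase_of_mem (by simp [hj]), Finset.card_erase_of_mem (Finset.mem_univ s),
      Finset.card_univ, Fintype.card_fin]
    rfl
  set i := Nat.find hex with hi_def
  obtain ⟨hik, hWi⟩ := Nat.find_spec hex
  have hmin : ∀ m, m ≤ k → W m ∈ X → i ≤ m := fun m hm hW => Nat.find_min' hex ⟨hm, hW⟩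
  have hcases : ∀ m, m ≤ k → W m ∈ X → m = i ∨ m = i + 1 := by
    intro m hm hW
    have h1 := hmin m hm hW
    by_contra hne
    exact hbetween (i := i) (m := i + 1) (n := m) (by omega) (by omega) hm hWi hW
  by_cases hnext : i + 1 ≤ k ∧ W (i + 1) ∈ X
  · obtain ⟨hi1k, hWi1⟩ := hnext
    left
    -- Two chain points together with all d vertices off s would exceed the d+1 vertices available.
    have hj : ∃ j, j ≠ s ∧ b j ∉ X := by
      by_contra! hall
      obtain ⟨j, hj⟩ := exists_ne s
      have hsub : sideVertices b s W (i + 1) j ⊆ X := by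
        rintro p ((rfl | rfl) | ⟨l, hl, -, rfl⟩)
        exacts [hWi1, hWi, hall l hl]
      have := Set.eq_of_subset_of_ncard_le hsub
        (by rw [hXcard, h.card_side (by omega) hi1k hj]) hXfin
      have h2 := hall j hj
      rw [← this, h.vertex_mem_side_iff (by omega) hi1k j hj] at h2
      exact h2 rfl
    obtain ⟨j, hj, hjX⟩ := hj
    refine ⟨i + 1, j, by omega, hi1k, hj, ?_⟩
    congr 1
    refine Set.eq_of_subset_of_ncard_le ?_ ?_ ?_
    · intro p hp
      rcases hvert p hp with ⟨m, hm, rfl⟩ | ⟨l, hl, rfl⟩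
      · rcases hcases m hm hp with rfl | rfl
        · exact Or.inl (Or.inr rfl)
        · exact Or.inl (Or.inl rfl)
      · exact Or.inr ⟨l, hl, fun hlj => hjX (hlj ▸ hp), rfl⟩
    · rw [hXcard, h.card_side (by omega) hi1k hj]
    · apply Set.finite_of_ncard_ne_zero
      rw [h.card_side (by omega) hi1k hj]
      omega
  · have hcases' : ∀ m, m ≤ k → W m ∈ X → m = i := by
      intro m hm hW
      rcases hcases m hm hW with rfl | rfl
      · rfl
      · exact absurd ⟨hm, hW⟩ hnext
    have hall : ∀ l, l ≠ s → b l ∈ X := by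
      by_contra! hno
      obtain ⟨j, hj, hjX⟩ := hno
      have := himage ((Finset.univ.erase s).erase j) {W i} fun p hp => by
        rcases hvert p hp with ⟨m, hm, rfl⟩ | ⟨l, hl, rfl⟩
        · rw [hcases' m hm hp]; simp
        · rw [Finset.coe_union, Finset.coe_image]
          exact Or.inl ⟨l, by simp [hl]; rintro rfl; exact hjX hp, rfl⟩
      rw [hcompl j hj, Finset.card_singleton] at this
      omega
    -- A single chain point over the whole opposite facet has W k in its hull, so this point must be
    -- W k.
    have hWk : W k ∈ X := ho ⟨h.chain_last_mem_convexHull hik hWi hall, Or.inl ⟨k, le_rfl, rfl⟩⟩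
    right
    change convexHull ℝ X = convexHull ℝ (lastVertices b s k W)
    congr 1
    refine (Set.eq_of_subset_of_ncard_le ?_ ?_ hXfin).symm
    · rintro p (rfl | ⟨l, hl, rfl⟩)
      exacts [hWk, hall l hl]
    · rw [hXcard, h.card_last]

theorem isTriangulation_iff (h : IsMedianChain b s k W) (hd : 2 ≤ d)
    (𝒯 : Set (Set (RSpace d))) :
    IsTriangulation (chainPoints b s k W) 𝒯 ↔ 𝒯 = chainFamily b s k W := by
  constructor
  · intro h𝒯
    exact h𝒯.eq_of_subset (fun S hS => h.mem_chainFamily hd (h𝒯.simplex S hS)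
      (h𝒯.vertices_subset S hS) (h𝒯.only_vertices S hS)) (h.isTriangulation hd)
  · rintro rfl
    exact h.isTriangulation hd

end IsMedianChain

end ChainTriangulation

/-! ### From clean lattice simplices of minimal volume to chains -/

section CleanSimplices

variable {d k : ℕ} {T : Set (RSpace d)}

theorem AffineBasis.coord_add_smul_sub (b : AffineBasis (Fin (d + 1)) ℝ (RSpace d))
    (l : Fin (d + 1)) (v w : RSpace d) (t : ℝ) :
    b.coord l (v + t • (w - v)) = (1 - t) * b.coord l v + t * b.coord l w := by
  have : v + t • (w - v) = (1 - t) • v + t • w := by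
    rw [sub_smul, smul_sub, one_smul]; abel
  rw [this, Convex.combo_affine_apply (by ring)]
  rfl

theorem IsCleanLatticeSimplex.exists_tightFrame (hT : IsCleanLatticeSimplex k T)
    (hvol : MeasureTheory.volume T =
      ENNReal.ofReal (((d : ℝ) * (k : ℝ) + 1) / (Nat.factorial d : ℝ))) :
    ∃ b : AffineBasis (Fin (d + 1)) ℝ (RSpace d), T = convexHull ℝ (Set.range b) ∧
      ∃ A, IsTightFrame (leadingCoord d) (homogMatrix b) A ∧
        (∀ p, homog p ∈ A ↔ p ∈ interiorLatticePoints T) ∧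
        |(homogMatrix b).det| = d * k + 1 := by
  obtain ⟨b, hb⟩ := hT.simplex.exists_affineBasis
  have hfin : (interiorLatticePoints T).Finite :=
    Set.finite_of_encard_eq_coe hT.points
  set A := (hfin.image homog).toFinset with hA
  have hcard : A.card = k := by
    have h1 : (homog '' interiorLatticePoints T).encard = k := by
      rw [homog_injective.encard_image, hT.points]
    rw [(hfin.image homog).encard_eq_coe_toFinset_card] at h1
    exact_mod_cast h1
  have hmem : ∀ p, homog p ∈ A ↔ p ∈ interiorLatticePoints T := by
    intro p
    rw [hA, Set.Finite.mem_toFinset, homog_injective.mem_set_image]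
  have hdet : |(homogMatrix b).det| = d * k + 1 := by
    rw [hb, volume_convexHull_range, ENNReal.ofReal_eq_ofReal_iff (by positivity)
      (by positivity)] at hvol
    have : (d.factorial : ℝ) ≠ 0 := by positivity
    exact (div_left_inj' this).1 hvol
  refine ⟨b, hb, A, ⟨⟨fun i => ?_, det_homogMatrix_ne_zero b.ind⟩, fun q => ?_, ?_⟩, hmem, hdet⟩
  · rw [homogMatrix_row, isLatticePoint_homog]
    apply hT.lattice
    rw [hb, polyVertices_convexHull_range]
    exact ⟨i, rfl⟩
  · have hint : ∀ p, p ∈ interiorLatticePoints T ↔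
        p ∈ integerLattice d ∧ ∀ i, 0 < bary (homogMatrix b) (homog p) i := by
      intro p
      rw [interiorLatticePoints, hb, b.interior_convexHull, bary_homog]
      exact and_comm
    constructor
    · intro hq
      obtain ⟨p, hp, rfl⟩ := (hfin.image homog).mem_toFinset.1 hq
      rw [isLatticePoint_homog]
      exact (hint p).1 hp
    · rintro ⟨h1, h2⟩
      obtain ⟨p, rfl⟩ := exists_homog_eq h1.2
      rw [isLatticePoint_homog] at h1
      exact (hmem p).2 ((hint p).2 ⟨h1, h2⟩)
  · rw [hdet, hcard, Fintype.card_fin]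
    push_cast
    ring

theorem collinear_of_isAxis {b : AffineBasis (Fin (d + 1)) ℝ (RSpace d)} {s : Fin (d + 1)}
    {A : Finset (Fin (d + 1) → ℝ)} (h : IsAxis (homogMatrix b) A s) {X : Set (RSpace d)}
    (hX : ∀ p ∈ X, homog p ∈ A) : Collinear ℝ (insert (b s) X) := by
  rw [collinear_iff_of_mem (Set.mem_insert _ _)]
  -- The direction of the median: d times the vector from `b s` to the centroid of the opposite
  -- facet.
  refine ⟨∑ l, (b l - b s), ?_⟩
  rintro p (rfl | hp)
  · exact ⟨0, by simp⟩
  have hA := h _ (hX p hp)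
  rw [bary_homog] at hA
  have hr : ∃ r, ∀ l, l ≠ s → b.coord l p = r := by
    by_cases hl : ∃ l, l ≠ s
    · obtain ⟨l, hl⟩ := hl
      exact ⟨b.coord l p, fun l' hl' => hA l' l hl' hl⟩
    · exact ⟨0, fun l hl' => absurd ⟨l, hl'⟩ hl⟩
  obtain ⟨r, hr⟩ := hr
  refine ⟨r, ?_⟩
  have h1 : ∑ l, b.coord l p • (b l - b s) = r • ∑ l, (b l - b s) := by
    rw [Finset.smul_sum]
    refine Finset.sum_congr rfl fun l _ => ?_
    by_cases hl : l = s
    · simp [hl]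
    · rw [hr l hl]
  rw [← h1, vadd_eq_add]
  simp only [smul_sub, Finset.sum_sub_distrib, ← Finset.sum_smul, b.sum_coord_apply_eq_one,
    b.linear_combination_coord_eq_self, one_smul, sub_add_cancel]

/-- On a line through `b s`, the coordinates off s grow linearly with the distance from `b s`. The
nearest point therefore has height 1/(dk+1) over every facet through `b s`; integrality and
positivity of coordinates fix the rest. -/
theorem isMedianChain_rayPoint (hd : 1 ≤ d) {b : AffineBasis (Fin (d + 1)) ℝ (RSpace d)}
    {A : Finset (Fin (d + 1) → ℝ)} {s : Fin (d + 1)} {w : RSpace d} {X : Set (RSpace d)}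
    (hA : IsTightFrame (leadingCoord d) (homogMatrix b) A) (hX : ∀ p, homog p ∈ A ↔ p ∈ X)
    (hdet : |(homogMatrix b).det| = d * k + 1) (hcol : Collinear ℝ (insert (b s) X))
    (hwX : w ∈ X) (hw : ∀ y ∈ X, dist (b s) w ≤ dist (b s) y) :
    IsMedianChain b s k (rayPoint (b s) w) ∧
      X = {x | ∃ i : ℕ, 1 ≤ i ∧ i ≤ k ∧ x = rayPoint (b s) w i} := by
  have hι : 2 ≤ Fintype.card (Fin (d + 1)) := by rw [Fintype.card_fin]; omega
  have hnt : Nontrivial (Fin (d + 1)) := Fin.nontrivial_iff_two_le.2 (by omega)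
  obtain ⟨l₀, hl₀⟩ := exists_ne s
  have hN : (0 : ℝ) < d * k + 1 := by positivity
  have hpos : ∀ y ∈ X, ∀ l, 0 < b.coord l y := by
    intro y hy l
    have := hA.pos ((hX y).2 hy) l
    rwa [bary_homog] at this
  have hne : w ≠ b s := by
    rintro rfl
    have := hpos _ hwX l₀
    rw [b.coord_apply_ne hl₀] at this
    exact this.false
  have hscale : ∀ y ∈ X, ∃ t : ℝ, 1 ≤ t ∧ y = b s + t • (w - b s) := by
    intro y hy
    obtain ⟨u, hu⟩ := (collinear_iff_of_mem (Set.mem_insert _ _)).1 hcol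
    obtain ⟨r, hr⟩ := hu w (Set.mem_insert_of_mem _ hwX)
    obtain ⟨t, ht⟩ := hu y (Set.mem_insert_of_mem _ hy)
    have hr0 : r ≠ 0 := by
      rintro rfl
      exact hne (by simpa using hr)
    have hwu : w - b s = r • u := by rw [hr]; simp
    have hy' : y = b s + (t / r) • (w - b s) := by
      rw [hwu, smul_smul, div_mul_cancel₀ _ hr0, ht, vadd_eq_add, add_comm]
    refine ⟨t / r, ?_, hy'⟩
    have h1 := hpos y hy l₀
    rw [hy', b.coord_add_smul_sub, b.coord_apply_ne hl₀, mul_zero, zero_add] at h1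
    have h2 : 0 < t / r := pos_of_mul_pos_left h1 (hpos w hwX l₀).le
    have h3 := hw y hy
    rw [hy', dist_comm, dist_eq_norm, dist_eq_norm, sub_add_cancel_left, norm_neg, norm_smul,
      Real.norm_of_nonneg h2.le] at h3
    exact le_of_mul_le_mul_right (by linarith) (norm_pos_iff.2 (sub_ne_zero.2 hne))
  have hunit : ∀ l, l ≠ s → b.coord l w = 1 / (d * k + 1) := by
    intro l hl
    obtain ⟨x, hx, hx1, hmin⟩ := hA.exists_bary_mul_det_eq_one ⟨_, (hX w).2 hwX⟩ l
    obtain ⟨y, rfl⟩ := exists_homog_eq (hA.latticePoint hx).2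
    have h1 := hmin _ ((hX w).2 hwX)
    rw [hdet] at hx1
    simp only [bary_homog] at hx1 h1
    obtain ⟨t, ht, hy⟩ := hscale y ((hX y).1 hx)
    have h2 : b.coord l w ≤ b.coord l y := by
      rw [hy, b.coord_add_smul_sub, b.coord_apply_ne hl, mul_zero, zero_add]
      exact le_mul_of_one_le_left (hpos w hwX l).le ht
    rw [le_antisymm h2 h1, eq_div_iff hN.ne', hx1]
  have hcoord : ∀ (i : ℕ) l, l ≠ s →
      b.coord l (rayPoint (b s) w i) = i / ((d : ℝ) * k + 1) := by
    intro i l hl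
    rw [rayPoint, b.coord_add_smul_sub, b.coord_apply_ne hl, hunit l hl]
    ring
  have hchain : IsMedianChain b s k (rayPoint (b s) w) := fun i _ l hl => hcoord i l hl
  refine ⟨hchain, Set.Subset.antisymm (fun y hy => ?_) ?_⟩
  · obtain ⟨t, ht1, ht⟩ := hscale y hy
    have hyl : ∀ l, l ≠ s → b.coord l y = t / (d * k + 1) := by
      intro l hl
      rw [ht, b.coord_add_smul_sub, b.coord_apply_ne hl, hunit l hl]
      ring
    -- The parameter t equals (dk+1) times a coordinate of y, hence is an integer. Positivity of the
    -- s-coordinate gives dt < dk+1, that is t ≤ k.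
    obtain ⟨n, hn⟩ := hA.toIsLatticeFrame.exists_int_bary_mul_det
      (hA.latticePoint ((hX y).2 hy)) l₀
    rw [bary_homog, hdet] at hn
    simp only [hyl l₀ hl₀, div_mul_cancel₀ _ hN.ne'] at hn
    have hn1 : (1 : ℤ) ≤ n := by rw [hn] at ht1; exact_mod_cast ht1
    lift n to ℕ using by omega
    have htn : t = n := by exact_mod_cast hn
    refine ⟨n, by exact_mod_cast hn1, ?_, by rw [ht, rayPoint, htn]⟩
    have hs := b.sum_coord_apply_eq_one y
    rw [← Finset.add_sum_erase _ _ (Finset.mem_univ s), Finset.sum_congr rfl fun l hl =>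
      hyl l (Finset.ne_of_mem_erase hl), Finset.sum_const, Finset.card_erase_of_mem
      (Finset.mem_univ s), Finset.card_univ, Fintype.card_fin, nsmul_eq_mul,
      Nat.add_sub_cancel] at hs
    have h1 := hpos y hy s
    have h2 : (d : ℝ) * (t / (d * k + 1)) < 1 := by linarith
    rw [mul_div, div_lt_one hN, htn] at h2
    have h3 : d * n < d * k + 1 := by exact_mod_cast h2
    by_contra hlt
    have : d * (k + 1) ≤ d * n := Nat.mul_le_mul_left d (by omega)
    rw [mul_add] at this
    omega
  · rintro _ ⟨i, hi1, hik, rfl⟩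
    rw [← hX, hA.mem_iff, isLatticePoint_homog]
    refine ⟨?_, fun l => ?_⟩
    · have h1 := isLatticePoint_homog.1 (hA.row s)
      have h2 := isLatticePoint_homog.1 (hA.latticePoint ((hX w).2 hwX))
      intro m
      obtain ⟨n₁, hn₁⟩ := h1 m
      obtain ⟨n₂, hn₂⟩ := h2 m
      refine ⟨n₁ + i * (n₂ - n₁), ?_⟩
      simp [rayPoint, hn₁, hn₂]
    · simp only [bary_homog]
      by_cases hl : l = s
      · rw [hl, hchain.coord_apex hik, sub_pos, mul_div, div_lt_one hN]
        have : (i : ℝ) ≤ k := by exact_mod_cast hik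
        nlinarith [mul_le_mul_of_nonneg_left this (Nat.cast_nonneg (α := ℝ) d)]
      · rw [hcoord i l hl]
        have : (0 : ℝ) < i := by exact_mod_cast hi1
        positivity

theorem explicitFamily_eq_chainFamily {b : AffineBasis (Fin (d + 1)) ℝ (RSpace d)}
    (s : Fin (d + 1)) (w : RSpace d) (hb : polyVertices T = Set.range b) :
    explicitFamily k T (b s) w = chainFamily b s k (rayPoint (b s) w) := by
  have hside : ∀ i j, sideSimplex T (b s) w i (b j)
      = convexHull ℝ (sideVertices b s (rayPoint (b s) w) i j) := by
    intro i j
    rw [sideSimplex, hb]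
    congr 1
    ext p
    simp only [sideVertices, Set.mem_union, Set.mem_sdiff, Set.mem_range, Set.mem_insert_iff,
      Set.mem_singleton_iff, Set.mem_ofPred_eq, not_or]
    rw [or_comm]
    refine or_congr_right ?_
    constructor
    · rintro ⟨⟨l, rfl⟩, h1, h2⟩
      exact ⟨l, fun h => h2 (h ▸ rfl), fun h => h1 (h ▸ rfl), rfl⟩
    · rintro ⟨l, h1, h2, rfl⟩
      exact ⟨⟨l, rfl⟩, fun h => h2 (b.ind.injective h), fun h => h1 (b.ind.injective h)⟩
  have hlast : lastSimplex T (b s) w k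
      = convexHull ℝ (lastVertices b s k (rayPoint (b s) w)) := by
    rw [lastSimplex, hb]
    congr 1
    ext p
    simp only [lastVertices, Set.mem_union, Set.mem_sdiff, Set.mem_range,
      Set.mem_singleton_iff, Set.mem_ofPred_eq]
    rw [or_comm]
    refine or_congr_right ?_
    constructor
    · rintro ⟨⟨l, rfl⟩, h2⟩
      exact ⟨l, fun h => h2 (h ▸ rfl), rfl⟩
    · rintro ⟨l, h1, rfl⟩
      exact ⟨⟨l, rfl⟩, fun h => h1 (b.ind.injective h)⟩
  rw [explicitFamily, chainFamily, hlast]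
  congr 1
  ext S
  constructor
  · rintro ⟨i, hi1, hi, x, ⟨hx, hxs⟩, rfl⟩
    rw [hb] at hx
    obtain ⟨j, rfl⟩ := hx
    exact ⟨i, j, hi1, hi, fun h => hxs (h ▸ rfl), hside i j⟩
  · rintro ⟨i, j, hi1, hi, hj, rfl⟩
    refine ⟨i, hi1, hi, b j, ⟨hb ▸ ⟨j, rfl⟩, fun h => hj (b.ind.injective h)⟩, (hside i j).symm⟩

theorem IsCleanLatticeSimplex.inter_integerLattice (hT : IsCleanLatticeSimplex k T)
    (hclosed : IsClosed T) :
    T ∩ integerLattice d = interiorLatticePoints T ∪ polyVertices T := by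
  rw [← hT.clean, interiorLatticePoints, ← Set.union_inter_distrib_right]
  congr 1
  rw [← closure_eq_interior_union_frontier, hclosed.closure_eq]

end CleanSimplices

theorem mainTheorem4 (d k : ℕ) (hd : 3 ≤ d) (T : Set (RSpace d))
    (hT : IsCleanLatticeSimplex k T)
    (hvol : MeasureTheory.volume T =
      ENNReal.ofReal (((d : ℝ) * (k : ℝ) + 1) / (Nat.factorial d : ℝ))) :
    (∃! 𝒯 : Set (Set (RSpace d)), IsTriangulation (T ∩ integerLattice d) 𝒯) ∧
    (∃ v ∈ polyVertices T, Collinear ℝ (insert v (interiorLatticePoints T))) ∧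
    (∀ v ∈ polyVertices T, Collinear ℝ (insert v (interiorLatticePoints T)) →
      ∀ w₁ : RSpace d,
        (1 ≤ k → w₁ ∈ interiorLatticePoints T ∧
          ∀ w ∈ interiorLatticePoints T, dist v w₁ ≤ dist v w) →
        interiorLatticePoints T = {x | ∃ i : ℕ, 1 ≤ i ∧ i ≤ k ∧ x = rayPoint v w₁ i} ∧
        ∀ 𝒯 : Set (Set (RSpace d)),
          IsTriangulation (T ∩ integerLattice d) 𝒯 ↔ 𝒯 = explicitFamily k T v w₁) := by
  obtain ⟨b, hb, A, hA, hmem, hdet⟩ := hT.exists_tightFrame hvol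
  have hV : polyVertices T = Set.range b := by rw [hb, polyVertices_convexHull_range]
  have hclosed : IsClosed T := by
    rw [hb]; exact (Set.finite_range b).isClosed_convexHull ℝ
  have hvertex : ∃ v ∈ polyVertices T, Collinear ℝ (insert v (interiorLatticePoints T)) := by
    obtain ⟨s, hs⟩ := hA.exists_isAxis (by rw [Fintype.card_fin]; omega)
    exact ⟨b s, hV ▸ ⟨s, rfl⟩, collinear_of_isAxis hs fun p hp => (hmem p).2 hp⟩
  have hmain : ∀ v ∈ polyVertices T, Collinear ℝ (insert v (interiorLatticePoints T)) →
      ∀ w₁ : RSpace d,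
        (1 ≤ k → w₁ ∈ interiorLatticePoints T ∧
          ∀ w ∈ interiorLatticePoints T, dist v w₁ ≤ dist v w) →
        interiorLatticePoints T = {x | ∃ i : ℕ, 1 ≤ i ∧ i ≤ k ∧ x = rayPoint v w₁ i} ∧
        ∀ 𝒯 : Set (Set (RSpace d)),
          IsTriangulation (T ∩ integerLattice d) 𝒯 ↔ 𝒯 = explicitFamily k T v w₁ := by
    intro v hv hcol w hw
    rw [hV] at hv
    obtain ⟨s, rfl⟩ := hv
    have hchain : IsMedianChain b s k (rayPoint (b s) w) ∧ interiorLatticePoints T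
        = {x | ∃ i : ℕ, 1 ≤ i ∧ i ≤ k ∧ x = rayPoint (b s) w i} := by
      rcases Nat.eq_zero_or_pos k with rfl | hk
      · constructor
        · intro i hi l hl
          -- For k = 0 the point w is arbitrary: only the ray point of index 0, the vertex itself,
          -- enters.
          obtain rfl : i = 0 := by omega
          simp [rayPoint, b.coord_apply_ne hl]
        · have h0 := hT.points
          rw [Nat.cast_zero, Set.encard_eq_zero] at h0
          rw [h0, eq_comm, Set.eq_empty_iff_forall_notMem]
          rintro x ⟨i, h1, h2, -⟩
          omega
      · exact isMedianChain_rayPoint (by omega) hA hmem hdet hcol (hw hk).1 (hw hk).2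
    refine ⟨hchain.2, fun 𝒯 => ?_⟩
    have hpts : T ∩ integerLattice d = chainPoints b s k (rayPoint (b s) w) := by
      rw [hT.inter_integerLattice hclosed, hchain.2, hV]
      refine Set.Subset.antisymm (Set.union_subset ?_ hchain.1.range_subset_chainPoints) ?_
      · rintro _ ⟨i, -, hi, rfl⟩
        exact Or.inl ⟨i, hi, rfl⟩
      · rintro _ (⟨i, hi, rfl⟩ | ⟨l, -, rfl⟩)
        · rcases Nat.eq_zero_or_pos i with rfl | h1
          · exact Or.inr ⟨s, hchain.1.apply_zero.symm⟩
          · exact Or.inl ⟨i, h1, hi, rfl⟩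
        · exact Or.inr ⟨l, rfl⟩
    rw [hpts, explicitFamily_eq_chainFamily s w hV]
    exact hchain.1.isTriangulation_iff (by omega) 𝒯
  refine ⟨?_, hvertex, hmain⟩
  obtain ⟨v, hv, hcol⟩ := hvertex
  have hw : ∃ w₁ : RSpace d, 1 ≤ k → w₁ ∈ interiorLatticePoints T ∧
      ∀ w ∈ interiorLatticePoints T, dist v w₁ ≤ dist v w := by
    rcases (interiorLatticePoints T).eq_empty_or_nonempty with h0 | hne
    · have := hT.points
      rw [h0, Set.encard_empty] at this
      have hk : k = 0 := by exact_mod_cast this.symm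
      -- Any point serves as w₁ when there are no interior lattice points.
      exact ⟨v, fun h1 => by omega⟩
    · obtain ⟨w, hw, hmin⟩ := Set.exists_min_image _ (dist v)
        (Set.finite_of_encard_eq_coe hT.points) hne
      exact ⟨w, fun _ => ⟨hw, hmin⟩⟩
  obtain ⟨w, hw⟩ := hw
  have h := (hmain v hv hcol w hw).2
  exact ⟨_, (h _).2 rfl, fun 𝒯 h𝒯 => (h 𝒯).1 h𝒯⟩
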